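/- **Setting.** The domains are $\mathsf{public}\sqsubseteq\mathsf{verifier}\sqsubseteq\mathsf{prover}$, the stages $\mathsf{post}\sqsubseteq\mathsf{pre}$. Data types are $\mathsf{uint}$, $\mathsf{bool}$ (unbounded, only in stage $\mathsf{pre}$), $\mathsf{uint}[N]$, $\mathsf{bool}[N]$ ($N\ge 1$), the unit type $()$, and $\mathsf{list}[q]$, where $q=(t\,s\,d)$ is a qualified type (data type, stage, domain). Put $\langle d\rangle=\{d' : d\sqsubseteq d'\}$, $\langle\mathsf{pre}\rangle=\varnothing$, $\langle\mathsf{post}\rangle=\langle\mathsf{public}\rangle$, $\langle \mathsf{list}[t\,s\,d]\rangle=\langle t\rangle\cup\langle s\rangle\cup\langle d\rangle$, and $\langle t\rangle=\varnothing$ for other $t$. A qualified type $(t\,s\,d)$ is *well-structured* if $t$ is not a list type, and $s=\mathsf{pre}$ when $t=()$; or $t=\mathsf{list}[t'\,s'\,d']$ with $s=\mathsf{pre}$, $\langle s'\rangle\cup\langle d'\rangle\subseteq\langle d\rangle$ and $(t'\,s'\,d')$ well-structured. A type environment $\Gamma$ is a finite association list of items $x:q$ and $\mathsf{mut}\,x:b$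 with $b\in\{0,1\}$ (lookup takes the first match); it is well-structured if all its types are. **Typing** $\Gamma\vdash e:q\,!\,D$, where $D$ is a set of domains (the effect). Write $*$ for $()\,\mathsf{pre}\,\mathsf{public}$; an omitted modulus is allowed in stage $\mathsf{pre}$. - $\epsilon: *\,!\,\varnothing$; literals $n:\mathsf{uint}[N]\,s\,d\,!\,\langle s\rangle$ and $b:\mathsf{bool}[N]\,s\,d\,!\,\langle s\rangle$ for any $s,d$; $x:\Gamma(x)\,!\,\varnothing$. - $e_1+e_2:q\,!\,\langle s\rangle\cup D_1\cup D_2$ if both $e_i:q\,!\,D_i$, $q=\mathsf{uint}[N]\,s\,d$. - $\mathsf{assert}(e): *\,!\,\langle\mathsf{public}\rangle$ if $e:\mathsf{bool}[N]\,\mathsf{post}\,d$. - $(\mathsf{get}_{d}(k):q):q\,!\,\varnothing$ if all stages and domains in $q$, also inside list types, are $\mathsf{pre}$ and $d$. - $\mathsf{if}\ e_1\,\{e_2\}\ \mathsf{else}\,\{e_3\}:t\,s\,d\,!\,D_1\cup D_2\cup D_3$ if $e_1:\mathsf{bool}[N]\,\mathsf{pre}\,d'\,!\,D_1$, $e_i:t\,s\,d\,!\,D_i$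 ($i=2,3$), $\langle d'\rangle\supseteq\langle s\rangle\cup\langle d\rangle\cup D_2\cup D_3$. - $\mathsf{for}\ x\ \mathsf{in}\ e_1..e_2\,\{e_3\}:\mathsf{list}[t\,s\,d]\,\mathsf{pre}\,d'\,!\,D_1\cup D_2\cup D_3$ if $e_1,e_2:\mathsf{uint}\,\mathsf{pre}\,d'$ with effects $D_1,D_2$, $(x:\mathsf{uint}\,\mathsf{pre}\,d'),\Gamma\vdash e_3:t\,s\,d\,!\,D_3$, $\langle d'\rangle\supseteq\langle s\rangle\cup\langle d\rangle\cup D_3$. - $\mathsf{wire}\{e\}:t\,\mathsf{post}\,d\,!\,\langle\mathsf{public}\rangle$ if $e:t\,\mathsf{pre}\,d$, $t\in\{\mathsf{uint}[N],\mathsf{bool}[N]\}$. - $(e\ \mathsf{as}\ t\,s'\,d'):t\,s'\,d'\,!\,D$ if $e:t\,s\,d\,!\,D$, $s\sqsubseteq s'$, $d\sqsubseteq d'$, $\langle d'\rangle\supseteq\langle t\rangle$. - $(l=e): *\,!\,\langle s\rangle\cup\langle d\rangle\cup D\cup D'$ if $e:t\,s\,d\,!\,D$, $l:t\,s\,d\,!\,D'$,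 $l=x[y_1]\dots[y_n]$ and $\Gamma(\mathsf{mut}\,x)=1$. - $l[e]:q\,!\,D\cup D'$ if $l=x[y_1]\dots[y_n]$, $l:\mathsf{list}[q]\,s'\,d'\,!\,D'$, $e:\mathsf{uint}\,s'\,d'\,!\,D$. - $(\mathsf{let}\ \mathsf{mut}^b x=e_1;e_2):q_2\,!\,\langle d_1\rangle\cup D_1\cup D_2$ if $e_1:q_1\,!\,D_1$ with $q_1=t_1\,s_1\,d_1$ and $(\mathsf{mut}\,x:b),(x:q_1),\Gamma\vdash e_2:q_2\,!\,D_2$. $(e_1;e_2):q_2\,!\,D_1\cup D_2$ if $e_i:q_i\,!\,D_i$. The types that these rules give to literals, summands and arguments of $\mathsf{wire}$ are taken as part of the expression. **Circuit semantics.** A monadic value is $\top$ (unknown) or pure: a natural number, a Boolean $\mathbf{tt},\mathbf{ff}$, the unit value, or a finite list of monadic values. A value environment is a stack of pairs (variable, monadic value); lookup and update act on the first pair for a variable. An input dictionary triple $\phi$ gives for each domain $d$ and key $k$ a value $\phi_d(k)$ without $\top$. Streams $\omega=(\omega_{\mathsf{prover}},\omega_{\mathsf{verifier}})$ are two finite lists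 of monadic values. $[\![e]\!]\gamma\phi\omega$ fails or returns (value, environment, streams). It evaluates subexpressions from left to right, threads environment and streams, and fails if a part that is evaluated fails or is undefined (e.g. an index out of bounds). A literal has its value if $s=\mathsf{post}$ or $d=\mathsf{public}$, else $\top$. $x$ is looked up. $+$ adds (modulo $N$ for $\mathsf{uint}[N]$). $\mathsf{assert}$ fails iff its argument fails or is $\mathbf{ff}$. $\mathsf{get}_d(k)$ gives $\phi_d(k)$ if $d=\mathsf{public}$, else $\top$. $\mathsf{if}$ runs the branch chosen by a Boolean guard; otherwise it gives $\top$. $\mathsf{for}$ with bounds $i_1,i_2$ pushes $x$, runs $e_3$ for $x=i_1,\dots,i_2-1$ (setting $x$ before each run), pops $x$ and returns the list of results; it gives $\top$ if a bound is $\top$. $\mathsf{wire}\{e\}$ with $e$ in domain $d$ evaluates $e$, and gives its value if $d=\mathsf{public}$; otherwise it removes and returns the head of $\omega_d$, failing if that is empty. A cast to $t\,s\,d$ keeps the value if $s=\mathsf{post}$ or $d=\mathsf{public}$, else gives $\top$. $x[y_1]\dots[y_n]=e$ reads $x$, evaluates $y_1,\dots,y_n,e$, then sets $x$ to the value read, updated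 at these indices. $\mathsf{let}$ pushes $x$ and pops it afterwards. Operations on $\top$ (addition, indexing, updating in or at $\top$) give $\top$. **Compilation.** Circuits are built from constants $\mathrm{con}(n)$, operations (addition, multiplication modulo $N$) and input nodes $\mathrm{in}_d(k)$, $d\in\{\mathsf{prover},\mathsf{verifier}\}$. For a circuit input $\pi\in(\mathbb N^*)^2$, $c(\pi)$ is the value of $c$ with $\mathrm{in}_d(k)$ read as the entry of $\pi_d$ with index $k$ (from 0); it is undefined if an entry is missing. $|c|$ is the value of $c$ if $c$ has no input nodes, and $\top$ otherwise. Output circuits $o$ *accept* $\pi$ if $c(\pi)=0$ for every $c$ in $o$. Put $|\mathbf{tt}|=0$, $|\mathbf{ff}|=1$. A composite value is a pair $(\hat v,\hat c)$, where $\hat c$ is a circuit or $\top$ and $\hat v$ is $\top$, a number, a Boolean, unit, or a list of composite values. $[\![e]\!]_{\mathrm C}\gamma\phi\nu$, with $\nu\in\mathbb N^2$ the numbers of input nodes created so far, fails or returns (composite value, environment, list of output circuits, counters). It follows the circuit semantics, with output circuits concatenated, and with these clauses for composite values: a literal of value $u$ has $\hat v=u$ if $d=\mathsf{public}$ (else $\top$),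 $\hat c=\mathrm{con}(u)$ (resp. $\mathrm{con}(|u|)$) if $s=\mathsf{post}$ (else $\top$); $+$ adds values and makes an addition node of the circuits, each $\top$ if an argument is; $\mathsf{assert}$ appends the circuit of its argument to the output (failing if there is none); public $\mathsf{get}$ and $\epsilon$, loop variables, lists and updated lists have no circuit, nonpublic $\mathsf{get}$, unknown guards or bounds and lookups in or at $\top$ give $(\top,\top)$; a cast keeps $\hat v$ iff the target domain is $\mathsf{public}$ and $\hat c$ iff the target stage is $\mathsf{post}$, else puts $\top$; $\mathsf{wire}\{e\}$ with $e$ in domain $d$ keeps $\hat v$, and its circuit is $\mathrm{con}(n)$ or $\mathrm{con}(|b|)$ if $\hat v$ is $n\in\mathbb N$ or a Boolean $b$, and $\mathrm{in}_d(\nu_d)$ if $\hat v=\top$; if $d\neq\mathsf{public}$ then $\nu_d$ increases by 1. **Exactness.** For a primitive $t$, "$v\in t$" means that $v$ is a natural number, a Boolean, or unit, according to $t$. For a predicate $P$ on qualified types, $\hat v$ is *$(t\,s\,d)$-exact in $P$* if $P(t\,s\,d)$ is false and $\hat v=\top$, or $P(t\,s\,d)$ is true and either $t$ is primitive and $\hat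 v\in t$, or $t=\mathsf{list}[q']$ and $\hat v$ is a list of values $q'$-exact in $P$. *In circuit*: $P$ is "$s=\mathsf{post}$ or $d=\mathsf{public}$"; *in domain $d'$*: $P$ is "$d\sqsubseteq d'$". A composite $(\hat v,\hat c)$ is *$(t\,s\,d)$-exact* if: for $s=\mathsf{post}$, $\hat c$ is a circuit $c$, and $\hat v=n\in\mathbb N$ (resp. a Boolean $b$) implies $|c|=n$ (resp. $|b|$) and $|c|=c(\pi)$ for all $\pi$; for $s=\mathsf{pre}$, $\hat c=\top$; for $d=\mathsf{public}$, $\hat v\in t$ if $t$ is primitive, and $\hat v$ is a list of $q'$-exact pairs if $t=\mathsf{list}[q']$; for $d\ne\mathsf{public}$, $\hat v=\top$. An environment is *$\Gamma$-exact* (in circuit) if its variables are those of the typings in $\Gamma$, in order, and each value is exact (in circuit) for the corresponding type. **Correspondence.** $(\hat v,\hat c)\bullet\pi$ is $n$, $|b|$, unit, or the list of all $(\hat v_i,\hat c_i)\bullet\pi$, if $\hat v$ is $n\in\mathbb N$, a Boolean $b$, unit, or the list of the $(\hat v_i,\hat c_i)$; it is $c(\pi)$ if $\hat v=\top$, $\hat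 c=c$, and $\top$ if $\hat v=\hat c=\top$. On environments $\bullet\pi$ acts pointwise; $(\nu\bullet\pi)_d$ is $\pi_d$ without its first $\nu_d$ entries. The relation $\sim$ on monadic values is the least reflexive relation with $b\sim|b|$, $|b|\sim b$ for Booleans $b$ that is compatible with lists of equal length. For environments, $\gamma\sim\gamma'$ means that they have the same variables in order and $\gamma(x)\sim\gamma'(x)$ for each of them; for streams, $\sim$ is entrywise with equal lengths. An assertion with $\bullet\pi$ includes that $\bullet\pi$ is defined. **Theorem.** Let $\Gamma\vdash e:t\,s\,d\,!\,D$ with $\Gamma$ well-structured. Let the composite environment $\gamma$ be $\Gamma$-exact, let $\phi$ be type correct (for each subexpression $\mathsf{get}_{d_0}(k):q_0$ of $e$, $\phi_{d_0}(k)$ is $q_0$-exact in $d_0$), let $\nu\in\mathbb N^2$, and let $[\![e]\!]_{\mathrm C}\gamma\phi\nu=((\hat v,\hat c),\tilde\gamma,\tilde o,\tilde\nu)$. Let $\pi\in(\mathbb N^*)^2$, let $\gamma'$ be a value environment that is $\Gamma$-exact in circuit with $\gamma\bullet\pi\sim\gamma'$, and let $\omega'$ be streams with $\nu\bullet\pi\sim\omega'$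 that are type correct: whenever an input node $\mathrm{in}_{d_0}(k)$ has been created in the compilation by a $\mathsf{wire}$ expression of data type $t_0$, the entry of $\omega'_{d_0}$ with index $k-\nu_{d_0}$ (from 0), if it exists, belongs to $t_0$. Then: 1. If $[\![e]\!]\gamma'\phi\omega'=(\hat v',\tilde\gamma',\tilde\omega')$, then $\tilde o$ accepts $\pi$; moreover $\tilde\gamma\bullet\pi\sim\tilde\gamma'$ and $\tilde\nu\bullet\pi\sim\tilde\omega'$, and if $d=\mathsf{public}$ or $s=\mathsf{post}$ then $(\hat v,\hat c)\bullet\pi\sim\hat v'$. 2. If $[\![e]\!]\gamma'\phi\omega'$ fails, while every input node created in the compilation has an entry in $\pi$, then $\tilde o$ does not accept $\pi$. -/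

import Mathlib

namespace ZKSC

/-! ## Types and expressions -/

/-- Variables. -/
abbrev Var := String

/-- Keys of the input dictionaries. -/
abbrev Key := String

/-- Domains, in the order of growing privacy `pub ≤ verifier ≤ prover`. -/
inductive Domain
  | pub
  | verifier
  | prover
  deriving DecidableEq

def Domain.rank : Domain → ℕ
  | .pub => 0
  | .verifier => 1
  | .prover => 2

instance : LE Domain := ⟨fun d d' => d.rank ≤ d'.rank⟩

/-- The two parties that deliver values to the circuit (the non-public domains). -/
inductive Party
  | verifier
  | prover
  deriving DecidableEq

/-- The party of a non-public domain; the public domain has none. -/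
def Domain.party : Domain → Option Party
  | .pub => none
  | .verifier => some .verifier
  | .prover => some .prover

/-- Stages, ordered by `post ≤ pre`. -/
inductive Stage
  | post
  | pre
  deriving DecidableEq

def Stage.rank : Stage → ℕ
  | .post => 0
  | .pre => 1

instance : LE Stage := ⟨fun s s' => s.rank ≤ s'.rank⟩

/-- Data types. `uint none`, `bool none` are the types of unbounded integers and of local booleans;
`uint (some N)`, `bool (some N)` are the types `uint[N]`, `bool[N]`.
`list t s d` is the type of lists whose elements have the qualified type `t s d`. -/
inductive DataType
  | uint (m : Option ℕ+)
  | bool (m : Option ℕ+)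
  | unit
  | list (t : DataType) (s : Stage) (d : Domain)

/-- Qualified types. -/
structure QType where
  data : DataType
  stage : Stage
  dom : Domain

/-- Expressions. Where the semantics of an expression depends on the type of a part of it, that type
is written in the expression: literals carry their modulus, stage and domain, an addition carries
the modulus of its operands, `wire t d e` carries the data type and the domain of `e`.
`eps` is the missing expression, `letIn b x e₁ e₂` is `let mutᵇ x = e₁; e₂`,
`loop x e₁ e₂ e₃` is `for x in e₁ .. e₂ { e₃ }`, and `load l e` is `l[e]`. -/
inductive Expr
  | eps
  | natLit (n : ℕ) (m : Option ℕ+) (s : Stage) (d : Domain)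
  | boolLit (b : Bool) (m : Option ℕ+) (s : Stage) (d : Domain)
  | var (x : Var)
  | add (m : Option ℕ+) (e₁ e₂ : Expr)
  | assertion (e : Expr)
  | get (d : Domain) (k : Key) (q : QType)
  | cond (e₁ e₂ e₃ : Expr)
  | loop (x : Var) (e₁ e₂ e₃ : Expr)
  | wire (t : DataType) (d : Domain) (e : Expr)
  | cast (e : Expr) (q : QType)
  | assign (l e : Expr)
  | load (l e : Expr)
  | letIn (b : Bool) (x : Var) (e₁ e₂ : Expr)
  | seq (e₁ e₂ : Expr)

/-- `l.root = some x` iff `l` is an L-value `x[y₁]…[yₙ]` over the variable `x`. -/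
def Expr.root : Expr → Option Var
  | .var x => some x
  | .load l _ => l.root
  | _ => none

/-- The subexpressions of the form `get_d(k) : q`. -/
def Expr.gets : Expr → List (Domain × Key × QType)
  | .eps => []
  | .natLit _ _ _ _ => []
  | .boolLit _ _ _ _ => []
  | .var _ => []
  | .add _ e₁ e₂ => e₁.gets ++ e₂.gets
  | .assertion e => e.gets
  | .get d k q => [(d, k, q)]
  | .cond e₁ e₂ e₃ => e₁.gets ++ e₂.gets ++ e₃.gets
  | .loop _ e₁ e₂ e₃ => e₁.gets ++ e₂.gets ++ e₃.gets
  | .wire _ _ e => e.gets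
  | .cast e _ => e.gets
  | .assign l e => l.gets ++ e.gets
  | .load l e => l.gets ++ e.gets
  | .letIn _ _ e₁ e₂ => e₁.gets ++ e₂.gets
  | .seq e₁ e₂ => e₁.gets ++ e₂.gets

/-! ## Static semantics -/

/-- The components of a type environment: `x : q` and `mut x : b`. -/
inductive TyEntry
  | typing (x : Var) (q : QType)
  | mutability (x : Var) (b : Bool)

abbrev TyEnv := List TyEntry

/-- `Γ(x)`. -/
def TyEnv.lookupType : TyEnv → Var → Option QType
  | [], _ => none
  | .typing y q :: Γ, x => if y = x then some q else lookupType Γ x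
  | .mutability _ _ :: Γ, x => lookupType Γ x

/-- `Γ(mut x)`. -/
def TyEnv.lookupMut : TyEnv → Var → Option Bool
  | [], _ => none
  | .typing _ _ :: Γ, x => lookupMut Γ x
  | .mutability y b :: Γ, x => if y = x then some b else lookupMut Γ x

/-- The associations of variables to qualified types, in order. -/
def TyEnv.typings : TyEnv → List (Var × QType)
  | [] => []
  | .typing x q :: Γ => (x, q) :: typings Γ
  | .mutability _ _ :: Γ => typings Γ

/-- `⟨d⟩`: the domain `d` and all larger domains. -/
def Domain.up (d : Domain) : Set Domain := {d' | d ≤ d'}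

/-- `⟨s⟩`. -/
def Stage.up : Stage → Set Domain
  | .pre => ∅
  | .post => Domain.up .pub

/-- `⟨t⟩`. -/
def DataType.up : DataType → Set Domain
  | .list t s d => t.up ∪ s.up ∪ d.up
  | _ => ∅

/-- `allpre_d'(t s d)`. -/
def allPre (d' : Domain) : DataType → Stage → Domain → Prop
  | .list t₁ s₁ d₁, s, d => s = .pre ∧ d = d' ∧ allPre d' t₁ s₁ d₁
  | _, s, d => s = .pre ∧ d = d'

/-- The typing judgement `Γ ⊢ e : q ! D`. Unbounded integers and booleans without modulus are
available in the stage `pre` only. -/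
inductive HasType : TyEnv → Expr → QType → Set Domain → Prop
  | eps {Γ} : HasType Γ .eps ⟨.unit, .pre, .pub⟩ ∅
  | natLit {Γ n m s d} (hm : m = none → s = .pre) :
      HasType Γ (.natLit n m s d) ⟨.uint m, s, d⟩ s.up
  | boolLit {Γ b m s d} (hm : m = none → s = .pre) :
      HasType Γ (.boolLit b m s d) ⟨.bool m, s, d⟩ s.up
  | var {Γ x q} (h : TyEnv.lookupType Γ x = some q) : HasType Γ (.var x) q ∅
  | add {Γ e₁ e₂ m s d D₁ D₂} (hm : m = none → s = .pre)
      (h₁ : HasType Γ e₁ ⟨.uint m, s, d⟩ D₁) (h₂ : HasType Γ e₂ ⟨.uint m, s, d⟩ D₂) :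
      HasType Γ (.add m e₁ e₂) ⟨.uint m, s, d⟩ (s.up ∪ D₁ ∪ D₂)
  | assertion {Γ e N d D} (h : HasType Γ e ⟨.bool (some N), .post, d⟩ D) :
      HasType Γ (.assertion e) ⟨.unit, .pre, .pub⟩ (Domain.up .pub)
  | get {Γ d' k t s d} (h : allPre d' t s d) :
      HasType Γ (.get d' k ⟨t, s, d⟩) ⟨t, s, d⟩ ∅
  | cond {Γ e₁ e₂ e₃ m d' t s d D₁ D₂ D₃}
      (h₁ : HasType Γ e₁ ⟨.bool m, .pre, d'⟩ D₁)
      (h₂ : HasType Γ e₂ ⟨t, s, d⟩ D₂) (h₃ : HasType Γ e₃ ⟨t, s, d⟩ D₃)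
      (hd : s.up ∪ d.up ∪ D₂ ∪ D₃ ⊆ d'.up) :
      HasType Γ (.cond e₁ e₂ e₃) ⟨t, s, d⟩ (D₁ ∪ D₂ ∪ D₃)
  | loop {Γ x e₁ e₂ e₃ d' t s d D₁ D₂ D₃}
      (h₁ : HasType Γ e₁ ⟨.uint none, .pre, d'⟩ D₁)
      (h₂ : HasType Γ e₂ ⟨.uint none, .pre, d'⟩ D₂)
      (h₃ : HasType (.typing x ⟨.uint none, .pre, d'⟩ :: Γ) e₃ ⟨t, s, d⟩ D₃)
      (hd : s.up ∪ d.up ∪ D₃ ⊆ d'.up) :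
      HasType Γ (.loop x e₁ e₂ e₃) ⟨.list t s d, .pre, d'⟩ (D₁ ∪ D₂ ∪ D₃)
  | wire {Γ e N t d D} (ht : t = .uint (some N) ∨ t = .bool (some N))
      (h : HasType Γ e ⟨t, .pre, d⟩ D) :
      HasType Γ (.wire t d e) ⟨t, .post, d⟩ (Domain.up .pub)
  | cast {Γ e t s d s' d' D} (h : HasType Γ e ⟨t, s, d⟩ D)
      (hs : s ≤ s') (hd : d ≤ d') (ht : t.up ⊆ d'.up) :
      HasType Γ (.cast e ⟨t, s', d'⟩) ⟨t, s', d'⟩ D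
  | assign {Γ l e x t s d D D'} (h : HasType Γ e ⟨t, s, d⟩ D) (hl : HasType Γ l ⟨t, s, d⟩ D')
      (hx : l.root = some x) (hm : TyEnv.lookupMut Γ x = some true) :
      HasType Γ (.assign l e) ⟨.unit, .pre, .pub⟩ (s.up ∪ d.up ∪ D ∪ D')
  | load {Γ l e x t s d s' d' D D'} (hx : l.root = some x)
      (hl : HasType Γ l ⟨.list t s d, s', d'⟩ D') (h : HasType Γ e ⟨.uint none, s', d'⟩ D) :
      HasType Γ (.load l e) ⟨t, s, d⟩ (D ∪ D')
  | letIn {Γ b x e₁ e₂ t₁ s₁ d₁ t₂ s₂ d₂ D₁ D₂} (h₁ : HasType Γ e₁ ⟨t₁, s₁, d₁⟩ D₁)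
      (h₂ : HasType (.mutability x b :: .typing x ⟨t₁, s₁, d₁⟩ :: Γ) e₂ ⟨t₂, s₂, d₂⟩ D₂) :
      HasType Γ (.letIn b x e₁ e₂) ⟨t₂, s₂, d₂⟩ (d₁.up ∪ D₁ ∪ D₂)
  | seq {Γ e₁ e₂ q₁ q₂ D₁ D₂} (h₁ : HasType Γ e₁ q₁ D₁) (h₂ : HasType Γ e₂ q₂ D₂) :
      HasType Γ (.seq e₁ e₂) q₂ (D₁ ∪ D₂)

/-- Well-structured qualified types. -/
def WellStructured : DataType → Stage → Domain → Prop
  | .uint _, _, _ => True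
  | .bool _, _, _ => True
  | .unit, s, _ => s = .pre
  | .list t' s' d', s, d => s = .pre ∧ s'.up ∪ d'.up ⊆ d.up ∧ WellStructured t' s' d'

/-- Well-structured type environments. -/
def TyEnv.WellStructured (Γ : TyEnv) : Prop :=
  ∀ a ∈ Γ.typings, ZKSC.WellStructured a.2.data a.2.stage a.2.dom

/-! ## Values and environments -/

/-- The set `U` of core values. -/
inductive Core
  | nat (n : ℕ)
  | bool (b : Bool)
  | unit
  | list (l : List Core)

/-- The set `M V` of monadic values: `top` is the unknown value, the other constructors are the pure
values (`pure n`, `pure b`, the pure unit value, and pure finite sequences of monadic values). -/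
inductive MVal
  | top
  | nat (n : ℕ)
  | bool (b : Bool)
  | unit
  | list (l : List MVal)

/-- Association lists, used as stacks. -/
abbrev Assoc (α : Type) := List (Var × α)

/-- `γ(x)`: the value in the first association of `x`. -/
def Assoc.find {α : Type} : Assoc α → Var → Option α
  | [], _ => none
  | (y, a) :: γ, x => if y = x then some a else find γ x

/-- `[x ↦ a]γ`: the first association of `x` is updated. -/
def Assoc.update {α : Type} : Assoc α → Var → α → Assoc α
  | [], _, _ => []
  | (y, b) :: γ, x, a => if y = x then (y, a) :: γ else (y, b) :: update γ x a

/-- Value environments. -/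
abbrev Env := Assoc MVal

/-- Triples of input dictionaries. -/
abbrev Inputs := Domain → Key → Core

/-- Pairs of streams of values delivered to the circuit. -/
abbrev Streams := Party → List MVal

mutual
/-- `allpure`. -/
def Core.allPure : Core → MVal
  | .nat n => .nat n
  | .bool b => .bool b
  | .unit => .unit
  | .list l => .list (Core.allPureList l)
def Core.allPureList : List Core → List MVal
  | [] => []
  | u :: l => u.allPure :: Core.allPureList l
end

/-- The integer `|b|` that represents the Boolean `b` in the circuit: `|tt| = 0`, `|ff| = 1`. -/
def code (b : Bool) : ℕ := if b then 0 else 1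

/-- Reduction modulo `N`, if there is a modulus. -/
def reduce : Option ℕ+ → ℕ → ℕ
  | none, n => n
  | some N, n => n % (N : ℕ)

/-- `do {i₁ ← v₁; i₂ ← v₂; pure (i₁ + i₂)}`; `none` means that the sum is not defined. -/
def MVal.add (m : Option ℕ+) : MVal → MVal → Option MVal
  | .top, _ => some .top
  | _, .top => some .top
  | .nat i₁, .nat i₂ => some (.nat (reduce m (i₁ + i₂)))
  | _, _ => none

/-- `do {a ← v; i ← w; aᵢ}`; `none` means that the lookup is not defined. -/
def MVal.index : MVal → MVal → Option MVal
  | .top, _ => some .top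
  | _, .top => some .top
  | .list l, .nat i => l[i]?
  | _, _ => none

/-- `upd`; `none` means that the update is not defined (index out of bounds). -/
def MVal.upd : MVal → List MVal → MVal → Option MVal
  | _, [], v => some v
  | .top, _ :: _, _ => some .top
  | _, .top :: _, _ => some .top
  | .list l, .nat i :: is, v => do
      let a ← l[i]?
      let a' ← MVal.upd a is v
      some (.list (l.set i a'))
  | _, _ :: _, _ => none

/-! ## Circuit semantics -/

/-- The iterations of a `for` loop in the circuit semantics: `n` runs of the body, the loop
variable `x` being set to `i`, `i + 1`, … -/
def circuitLoop (body : Env → Streams → Option (MVal × Env × Streams)) (x : Var) :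
    ℕ → ℕ → Env → Streams → Option (List MVal × Env × Streams)
  | 0, _, γ, ω => some ([], γ, ω)
  | n + 1, i, γ, ω => do
      let (a, γ₁, ω₁) ← body (Assoc.update γ x (.nat i)) ω
      let (as, γ₂, ω₂) ← circuitLoop body x n (i + 1) γ₁ ω₁
      some (a :: as, γ₂, ω₂)

mutual
/-- The circuit semantics `⟦e⟧ γ φ ω`; `none` means failure. -/
def circuitSem (φ : Inputs) : Expr → Env → Streams → Option (MVal × Env × Streams)
  | .eps, γ, ω => some (.unit, γ, ω)
  | .natLit n _ s d, γ, ω =>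
      some (if s = .post ∨ d = .pub then .nat n else .top, γ, ω)
  | .boolLit b _ s d, γ, ω =>
      some (if s = .post ∨ d = .pub then .bool b else .top, γ, ω)
  | .var x, γ, ω => do
      let v ← Assoc.find γ x
      some (v, γ, ω)
  | .add m e₁ e₂, γ₀, ω₀ => do
      let (v₁, γ₁, ω₁) ← circuitSem φ e₁ γ₀ ω₀
      let (v₂, γ₂, ω₂) ← circuitSem φ e₂ γ₁ ω₁
      let v ← MVal.add m v₁ v₂
      some (v, γ₂, ω₂)
  | .assertion e, γ₀, ω₀ => do
      let (v, γ₁, ω₁) ← circuitSem φ e γ₀ ω₀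
      match v with
      | .bool false => none
      | _ => some (.unit, γ₁, ω₁)
  | .get d k _, γ, ω =>
      some (if d = .pub then (φ d k).allPure else .top, γ, ω)
  | .cond e₁ e₂ e₃, γ₀, ω₀ => do
      let (v₁, γ₁, ω₁) ← circuitSem φ e₁ γ₀ ω₀
      match v₁ with
      | .bool true => circuitSem φ e₂ γ₁ ω₁
      | .bool false => circuitSem φ e₃ γ₁ ω₁
      | _ => some (.top, γ₁, ω₁)
  | .loop x e₁ e₂ e₃, γ₀, ω₀ => do
      let (v₁, γ₁, ω₁) ← circuitSem φ e₁ γ₀ ω₀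
      let (v₂, γ₂, ω₂) ← circuitSem φ e₂ γ₁ ω₁
      match v₁, v₂ with
      | .nat i₁, .nat i₂ => do
          let (as, γ₃, ω₃) ← circuitLoop (fun γ ω => circuitSem φ e₃ γ ω) x (i₂ - i₁) i₁
            ((x, .nat i₁) :: γ₂) ω₂
          some (.list as, γ₃.tail, ω₃)
      | .top, _ => some (.top, γ₂, ω₂)
      | _, .top => some (.top, γ₂, ω₂)
      | _, _ => none
  | .wire _ d e, γ, ω => do
      let (v, γ₁, ω₁) ← circuitSem φ e γ ω
      match d.party with
      | none => some (v, γ₁, ω₁)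
      | some p => do
          let h ← (ω₁ p).head?
          some (h, γ₁, fun p' => if p' = p then (ω₁ p').tail else ω₁ p')
  | .cast e q, γ, ω => do
      let (v, γ₁, ω₁) ← circuitSem φ e γ ω
      some (if q.stage = .post ∨ q.dom = .pub then v else .top, γ₁, ω₁)
  | .assign l e, γ₀, ω₀ => do
      let x ← l.root
      let a ← Assoc.find γ₀ x
      let (is, γₙ, ωₙ) ← circuitIndices φ l γ₀ ω₀
      let (v, γ', ω') ← circuitSem φ e γₙ ωₙ
      let a' ← MVal.upd a is v
      some (.unit, Assoc.update γ' x a', ω')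
  | .load l e, γ₀, ω₀ => do
      let (a, γ₁, ω₁) ← circuitSem φ l γ₀ ω₀
      let (i, γ₂, ω₂) ← circuitSem φ e γ₁ ω₁
      let v ← MVal.index a i
      some (v, γ₂, ω₂)
  | .letIn _ x e₁ e₂, γ₀, ω₀ => do
      let (v₁, γ₁, ω₁) ← circuitSem φ e₁ γ₀ ω₀
      let (v₂, γ₂, ω₂) ← circuitSem φ e₂ ((x, v₁) :: γ₁) ω₁
      some (v₂, γ₂.tail, ω₂)
  | .seq e₁ e₂, γ₀, ω₀ => do
      let (_, γ₁, ω₁) ← circuitSem φ e₁ γ₀ ω₀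
      circuitSem φ e₂ γ₁ ω₁
/-- Evaluation of the indices `y₁, …, yₙ` of an L-value `x[y₁]…[yₙ]`, from left to right. -/
def circuitIndices (φ : Inputs) : Expr → Env → Streams → Option (List MVal × Env × Streams)
  | .var _, γ, ω => some ([], γ, ω)
  | .load l y, γ₀, ω₀ => do
      let (is, γ₁, ω₁) ← circuitIndices φ l γ₀ ω₀
      let (i, γ₂, ω₂) ← circuitSem φ y γ₁ ω₁
      some (is ++ [i], γ₂, ω₂)
  | _, _, _ => none
end

/-! ## Circuits -/

/-- The operations of a circuit. -/
inductive CircuitOp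
  | add
  | mul

def CircuitOp.apply : CircuitOp → ℕ → ℕ → ℕ
  | .add, a, b => a + b
  | .mul, a, b => a * b

/-- Arithmetic circuits, given by a root: constant nodes, operation nodes (addition or
multiplication modulo `N`), and input nodes (number `k` of the party `p`). -/
inductive Circuit
  | con (n : ℕ)
  | op (o : CircuitOp) (N : ℕ+) (c₁ c₂ : Circuit)
  | inp (p : Party) (k : ℕ)

/-- The value `|c|` of a circuit without its input; `none` is the unknown value. -/
def Circuit.closedValue : Circuit → Option ℕ
  | .con n => some n
  | .op o N c₁ c₂ => do
      let i₁ ← c₁.closedValue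
      let i₂ ← c₂.closedValue
      some (o.apply i₁ i₂ % (N : ℕ))
  | .inp _ _ => none

/-- Circuit inputs: a sequence of input values for each party. -/
abbrev CircuitInput := Party → List ℕ

/-- The value `c(π)` of a circuit on an input; `none` means that `π` lacks a needed input. -/
def Circuit.value (π : CircuitInput) : Circuit → Option ℕ
  | .con n => some n
  | .op o N c₁ c₂ => do
      let i₁ ← c₁.value π
      let i₂ ← c₂.value π
      some (o.apply i₁ i₂ % (N : ℕ))
  | .inp p k => (π p)[k]?

/-- A sequence of output circuits accepts `π` iff all of them evaluate to `0`. -/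
def Accepts (o : List Circuit) (π : CircuitInput) : Prop := ∀ c ∈ o, c.value π = some 0

/-! ## Compilation -/

/-- The set `M V_C`: unknown, or a pure composite value. -/
inductive CVal
  | top
  | nat (n : ℕ)
  | bool (b : Bool)
  | unit
  | list (l : List (CVal × Option Circuit))

/-- The pairs in `M V_C × M T`; a missing circuit is `none`. -/
abbrev Comp := CVal × Option Circuit

/-- Composite value environments. -/
abbrev CEnv := Assoc Comp

/-- The numbers of the input nodes created so far. -/
abbrev Counter := Party → ℕ

/-- A record of an input node: its party, its number, and the data type of the `wire` expression
that has created it. -/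
structure InputNode where
  party : Party
  number : ℕ
  type : DataType

/-- Result of compilation: composite value, environment, output circuits, counter; the last
component lists all input nodes that have been created, and nothing else depends on it. -/
abbrev CompileResult := Comp × CEnv × List Circuit × Counter × List InputNode

mutual
/-- `allpuretop`. -/
def Core.allPureTop : Core → Comp
  | .nat n => (.nat n, none)
  | .bool b => (.bool b, none)
  | .unit => (.unit, none)
  | .list l => (.list (Core.allPureTopList l), none)
def Core.allPureTopList : List Core → List Comp
  | [] => []
  | u :: l => u.allPureTop :: Core.allPureTopList l
end

/-- `do {i₁ ← v₁; i₂ ← v₂; pure (i₁ + i₂)}`; `none` means that the sum is not defined. -/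
def CVal.add (m : Option ℕ+) : CVal → CVal → Option CVal
  | .top, _ => some .top
  | _, .top => some .top
  | .nat i₁, .nat i₂ => some (.nat (reduce m (i₁ + i₂)))
  | _, _ => none

/-- The circuit of a sum, missing if a circuit of a summand is missing. (Sums of unbounded integers
exist in the stage `pre` only, where there are no circuits.) -/
def addCircuit (m : Option ℕ+) (c₁ c₂ : Option Circuit) : Option Circuit := do
  let N ← m
  let c₁ ← c₁
  let c₂ ← c₂
  some (.op .add N c₁ c₂)

/-- List lookup; `none` means that the lookup is not defined. -/
def CVal.index : CVal → CVal → Option Comp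
  | .top, _ => some (.top, none)
  | _, .top => some (.top, none)
  | .list l, .nat i => l[i]?
  | _, _ => none

/-- `upd_C`; `none` means that the update is not defined (index out of bounds). -/
def updC : Comp → List CVal → Comp → Option Comp
  | _, [], w => some w
  | (.top, _), _ :: _, _ => some (.top, none)
  | _, .top :: _, _ => some (.top, none)
  | (.list l, _), .nat i :: is, w => do
      let a ← l[i]?
      let a' ← updC a is w
      some (.list (l.set i a'), none)
  | _, _ :: _, _ => none

/-- The iterations of a `for` loop in compilation. -/
def compileLoop (body : CEnv → Counter → Option CompileResult) (x : Var) :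
    ℕ → ℕ → CEnv → Counter →
      Option (List Comp × CEnv × List Circuit × Counter × List InputNode)
  | 0, _, γ, ν => some ([], γ, [], ν, [])
  | n + 1, i, γ, ν => do
      let (a, γ₁, o₁, ν₁, ι₁) ← body (Assoc.update γ x (.nat i, none)) ν
      let (as, γ₂, o₂, ν₂, ι₂) ← compileLoop body x n (i + 1) γ₁ ν₁
      some (a :: as, γ₂, o₁ ++ o₂, ν₂, ι₁ ++ ι₂)

mutual
/-- Compilation `⟦e⟧_C γ φ ν`; `none` means that compilation fails. -/
def compile (φ : Inputs) : Expr → CEnv → Counter → Option CompileResult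
  | .eps, γ, ν => some ((.unit, none), γ, [], ν, [])
  | .natLit n _ s d, γ, ν =>
      some ((if d = .pub then .nat n else .top,
        if s = .post then some (.con n) else none), γ, [], ν, [])
  | .boolLit b _ s d, γ, ν =>
      some ((if d = .pub then .bool b else .top,
        if s = .post then some (.con (code b)) else none), γ, [], ν, [])
  | .var x, γ, ν => do
      let w ← Assoc.find γ x
      some (w, γ, [], ν, [])
  | .add m e₁ e₂, γ₀, ν₀ => do
      let ((v₁, c₁), γ₁, o₁, ν₁, ι₁) ← compile φ e₁ γ₀ ν₀
      let ((v₂, c₂), γ₂, o₂, ν₂, ι₂) ← compile φ e₂ γ₁ ν₁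
      let v ← CVal.add m v₁ v₂
      some ((v, addCircuit m c₁ c₂), γ₂, o₁ ++ o₂, ν₂, ι₁ ++ ι₂)
  | .assertion e, γ₀, ν₀ => do
      let ((_, c), γ₁, o₁, ν₁, ι₁) ← compile φ e γ₀ ν₀
      let c₁ ← c
      some ((.unit, none), γ₁, o₁ ++ [c₁], ν₁, ι₁)
  | .get d k _, γ, ν =>
      some (if d = .pub then (φ d k).allPureTop else (.top, none), γ, [], ν, [])
  | .cond e₁ e₂ e₃, γ₀, ν₀ => do
      let ((v₁, _), γ₁, o₁, ν₁, ι₁) ← compile φ e₁ γ₀ ν₀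
      match v₁ with
      | .bool true => do
          let (w, γ₂, o₂, ν₂, ι₂) ← compile φ e₂ γ₁ ν₁
          some (w, γ₂, o₁ ++ o₂, ν₂, ι₁ ++ ι₂)
      | .bool false => do
          let (w, γ₃, o₃, ν₃, ι₃) ← compile φ e₃ γ₁ ν₁
          some (w, γ₃, o₁ ++ o₃, ν₃, ι₁ ++ ι₃)
      | _ => some ((.top, none), γ₁, o₁, ν₁, ι₁)
  | .loop x e₁ e₂ e₃, γ₀, ν₀ => do
      let ((v₁, _), γ₁, o₁, ν₁, ι₁) ← compile φ e₁ γ₀ ν₀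
      let ((v₂, _), γ₂, o₂, ν₂, ι₂) ← compile φ e₂ γ₁ ν₁
      match v₁, v₂ with
      | .nat i₁, .nat i₂ => do
          let (as, γ₃, o₃, ν₃, ι₃) ← compileLoop (fun γ ν => compile φ e₃ γ ν) x (i₂ - i₁) i₁
            ((x, (.nat i₁, none)) :: γ₂) ν₂
          some ((.list as, none), γ₃.tail, o₁ ++ o₂ ++ o₃, ν₃, ι₁ ++ ι₂ ++ ι₃)
      | .top, _ => some ((.top, none), γ₂, o₁ ++ o₂, ν₂, ι₁ ++ ι₂)
      | _, .top => some ((.top, none), γ₂, o₁ ++ o₂, ν₂, ι₁ ++ ι₂)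
      | _, _ => none
  | .wire t d e, γ, ν => do
      let ((v, _), γ₁, o₁, ν₁, ι₁) ← compile φ e γ ν
      let ν₂ : Counter := fun p => if d.party = some p then ν₁ p + 1 else ν₁ p
      match v with
      | .nat n => some ((v, some (.con n)), γ₁, o₁, ν₂, ι₁)
      | .bool b => some ((v, some (.con (code b))), γ₁, o₁, ν₂, ι₁)
      | .top => do
          let p ← d.party
          some ((v, some (.inp p (ν₁ p))), γ₁, o₁, ν₂, ι₁ ++ [⟨p, ν₁ p, t⟩])
      | _ => none
  | .cast e q, γ₀, ν₀ => do
      let ((v₁, c₁), γ₁, o₁, ν₁, ι₁) ← compile φ e γ₀ ν₀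
      some ((if q.dom = .pub then v₁ else .top, if q.stage = .post then c₁ else none),
        γ₁, o₁, ν₁, ι₁)
  | .assign l e, γ₀, ν₀ => do
      let x ← l.root
      let a ← Assoc.find γ₀ x
      let (is, γₙ, oₙ, νₙ, ιₙ) ← compileIndices φ l γ₀ ν₀
      let (w, γ', o', ν', ι') ← compile φ e γₙ νₙ
      let a' ← updC a is w
      some ((.unit, none), Assoc.update γ' x a', oₙ ++ o', ν', ιₙ ++ ι')
  | .load l e, γ₀, ν₀ => do
      let ((a, _), γ₁, o₁, ν₁, ι₁) ← compile φ l γ₀ ν₀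
      let ((i, _), γ₂, o₂, ν₂, ι₂) ← compile φ e γ₁ ν₁
      let w ← CVal.index a i
      some (w, γ₂, o₁ ++ o₂, ν₂, ι₁ ++ ι₂)
  | .letIn _ x e₁ e₂, γ₀, ν₀ => do
      let (w₁, γ₁, o₁, ν₁, ι₁) ← compile φ e₁ γ₀ ν₀
      let (w₂, γ₂, o₂, ν₂, ι₂) ← compile φ e₂ ((x, w₁) :: γ₁) ν₁
      some (w₂, γ₂.tail, o₁ ++ o₂, ν₂, ι₁ ++ ι₂)
  | .seq e₁ e₂, γ₀, ν₀ => do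
      let (_, γ₁, o₁, ν₁, ι₁) ← compile φ e₁ γ₀ ν₀
      let (w₂, γ₂, o₂, ν₂, ι₂) ← compile φ e₂ γ₁ ν₁
      some (w₂, γ₂, o₁ ++ o₂, ν₂, ι₁ ++ ι₂)
/-- Compilation of the indices of an L-value, from left to right. -/
def compileIndices (φ : Inputs) : Expr → CEnv → Counter →
    Option (List CVal × CEnv × List Circuit × Counter × List InputNode)
  | .var _, γ, ν => some ([], γ, [], ν, [])
  | .load l y, γ₀, ν₀ => do
      let (is, γ₁, o₁, ν₁, ι₁) ← compileIndices φ l γ₀ ν₀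
      let ((i, _), γ₂, o₂, ν₂, ι₂) ← compile φ y γ₁ ν₁
      some (is ++ [i], γ₂, o₁ ++ o₂, ν₂, ι₁ ++ ι₂)
  | _, _, _ => none
end

/-! ## Exactness -/

/-- `v` is `pure u` with `u ∈ t`, for a primitive data type `t`. -/
def MVal.HasPrim : MVal → DataType → Prop
  | .nat _, .uint _ => True
  | .bool _, .bool _ => True
  | .unit, .unit => True
  | _, _ => False

/-- `v` is `pure u` with `u ∈ t`, for a primitive data type `t`. -/
def CVal.HasPrim : CVal → DataType → Prop
  | .nat _, .uint _ => True
  | .bool _, .bool _ => True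
  | .unit, .unit => True
  | _, _ => False

/-- `v` is `(t s d)`-exact in the predicate `P`. -/
def ExactIn (P : QType → Prop) : DataType → Stage → Domain → MVal → Prop
  | .list t' s' d', s, d, v =>
      (P ⟨.list t' s' d', s, d⟩ ∧ ∃ l, v = .list l ∧ ∀ w ∈ l, ExactIn P t' s' d' w) ∨
      (¬ P ⟨.list t' s' d', s, d⟩ ∧ v = .top)
  | t, s, d, v => (P ⟨t, s, d⟩ ∧ v.HasPrim t) ∨ (¬ P ⟨t, s, d⟩ ∧ v = .top)

/-- The types that are visible to the circuit. -/
def VisibleToCircuit (q : QType) : Prop := q.stage = .post ∨ q.dom = .pub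

/-- `γ` is `Γ`-exact in circuit. -/
def ExactInCircuit (Γ : TyEnv) (γ : Env) : Prop :=
  List.Forall₂ (fun a b => a.1 = b.1 ∧
    ExactIn VisibleToCircuit a.2.data a.2.stage a.2.dom b.2) Γ.typings γ

/-- The input dictionaries are type correct for `e`: for every subexpression `get_d(k) : q` of `e`,
the value `allpure (φ_d(k))` is `q`-exact in the domain `d`. -/
def TypeCorrectInputs (φ : Inputs) (e : Expr) : Prop :=
  ∀ d k q, (d, k, q) ∈ e.gets →
    ExactIn (fun q' => q'.dom ≤ d) q.data q.stage q.dom (φ d k).allPure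

/-- The part of exactness of a composite value that concerns the stage. -/
def StageExact (s : Stage) (w : Comp) : Prop :=
  (s = .post → ∃ c, w.2 = some c ∧
    (∀ n, w.1 = .nat n → c.closedValue = some n ∧ ∀ π, c.closedValue = c.value π) ∧
    (∀ b, w.1 = .bool b → c.closedValue = some (code b) ∧ ∀ π, c.closedValue = c.value π)) ∧
  (s = .pre → w.2 = none)

/-- The composite value `w` is `(t s d)`-exact. -/
def CompExact : DataType → Stage → Domain → Comp → Prop
  | .list t' s' d', s, d, w =>
      StageExact s w ∧
      (d = .pub → ∃ l, w.1 = .list l ∧ ∀ w' ∈ l, CompExact t' s' d' w') ∧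
      (d ≠ .pub → w.1 = .top)
  | t, s, d, w =>
      StageExact s w ∧ (d = .pub → w.1.HasPrim t) ∧ (d ≠ .pub → w.1 = .top)

/-- The composite value environment `γ` is `Γ`-exact. -/
def CEnvExact (Γ : TyEnv) (γ : CEnv) : Prop :=
  List.Forall₂ (fun a b => a.1 = b.1 ∧ CompExact a.2.data a.2.stage a.2.dom b.2) Γ.typings γ

/-! ## Correspondence of compiler states and states of the circuit semantics -/

mutual
/-- `(v, c) • π`; `none` means that `π` lacks an input that is needed. -/
def bullet (π : CircuitInput) : CVal → Option Circuit → Option MVal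
  | .nat n, _ => some (.nat n)
  | .bool b, _ => some (.nat (code b))
  | .unit, _ => some .unit
  | .list l, _ => do
      let l' ← bulletList π l
      some (.list l')
  | .top, some c => do
      let n ← c.value π
      some (.nat n)
  | .top, none => some .top
def bulletList (π : CircuitInput) : List (CVal × Option Circuit) → Option (List MVal)
  | [] => some []
  | (v, c) :: l => do
      let v' ← bullet π v c
      let l' ← bulletList π l
      some (v' :: l')
end

/-- `γ • π`. -/
def bulletEnv (π : CircuitInput) : CEnv → Option Env
  | [] => some []
  | (x, (v, c)) :: γ => do
      let v' ← bullet π v c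
      let γ' ← bulletEnv π γ
      some ((x, v') :: γ')

/-- `ν • π`. -/
def bulletCounter (ν : Counter) (π : CircuitInput) : Streams :=
  fun p => ((π p).drop (ν p)).map MVal.nat

/-- The relation `v ∼ v'` of equal encoding in the circuit. -/
inductive Sim : MVal → MVal → Prop
  | nat (n : ℕ) : Sim (.nat n) (.nat n)
  | bool (b : Bool) : Sim (.bool b) (.bool b)
  | boolNat (b : Bool) : Sim (.bool b) (.nat (code b))
  | natBool (b : Bool) : Sim (.nat (code b)) (.bool b)
  | unit : Sim .unit .unit
  | list {l l' : List MVal} (h : List.Forall₂ Sim l l') : Sim (.list l) (.list l')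
  | top : Sim .top .top

/-- `γ ∼ γ'`. -/
def EnvSim (γ γ' : Env) : Prop :=
  γ.map Prod.fst = γ'.map Prod.fst ∧
  ∀ x v v', Assoc.find γ x = some v → Assoc.find γ' x = some v' → Sim v v'

/-- `ω ∼ ω'`. -/
def StreamSim (ω ω' : Streams) : Prop := ∀ p, List.Forall₂ Sim (ω p) (ω' p)

/-- `(v, c) • π ∼ v'` (in particular, the left-hand side is defined). -/
def CompSim (w : Comp) (π : CircuitInput) (v' : MVal) : Prop :=
  ∃ v, bullet π w.1 w.2 = some v ∧ Sim v v'

/-- `γ • π ∼ γ'` (in particular, the left-hand side is defined). -/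
def CEnvSim (γ : CEnv) (π : CircuitInput) (γ' : Env) : Prop :=
  ∃ δ, bulletEnv π γ = some δ ∧ EnvSim δ γ'

/-- The streams `ω`, which supply the values for the input nodes from the number `ν_p` on, are type
correct: the value supplied for an input node that has been created by a `wire` expression of data
type `t` belongs to `t`. -/
def TypeCorrectStreams (ι : List InputNode) (ν : Counter) (ω : Streams) : Prop :=
  ∀ i ∈ ι, ∀ v, ν i.party ≤ i.number → (ω i.party)[i.number - ν i.party]? = some v →
    v.HasPrim i.type

/-- All created input nodes have a value in `π`. -/
def InputsAvailable (ι : List InputNode) (π : CircuitInput) : Prop :=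
  ∀ i ∈ ι, i.number < (π i.party).length

end ZKSC

open ZKSC

namespace ZKSC

/-! ## Related values -/

-- Compilation and the circuit semantics traverse an expression in the same order, and the theorem
-- is a simulation of one by the other, proved by induction on the expression (`simulates`). The
-- invariant for values is `ValRel`: both sides are exact for the type, and they correspond under
-- `π`. Exactness makes this rigid. A public value is known to both sides and is the same; a
-- non-public value of stage `post` is unknown to the compiler, but its circuit computes it from
-- `π`; a non-public value of stage `pre` is `⊤` on both sides (`valRel_uint_iff`,
-- `valRel_bool_iff`, `valRel_list_pub_iff`, `valRel_hidden_iff`). Exactness also removes the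
-- ambiguity of `Sim`, which identifies a Boolean with its code.
--
-- Guards, loop bounds and list indices have stage `pre`, so they are either equal and known on both
-- sides or unknown on both. Hence both executions choose the same branch, run the same iterations
-- and touch the same list entries, and an operation that is defined in compilation is defined in
-- the circuit semantics. Where something is unknown, the typing rules and well-structuredness force
-- the type of the result to be hidden, so `⊤` is a correct result.
--
-- After a successful compilation the circuit semantics can therefore fail in two ways only. An
-- assertion may meet a false Boolean; then its output circuit has the value 1 and `π` is not
-- accepted. Or a stream may be exhausted; then `π` has no entry for the input node just created.
-- `Simulated` states success and failure together, and `Simulated.bind` composes consecutive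
-- evaluations.
--
-- The correspondence of environments sees only the first association of each variable, while the
-- end of a scope uncovers shadowed ones. `EnvRel` therefore records by flags at which positions
-- values correspond, and these flags stay fixed during evaluation.

/-- The composite value `w` and the value `v'` are exact for `q` and correspond under `π`. -/
def ValRel (π : CircuitInput) (q : QType) (w : Comp) (v' : MVal) : Prop :=
  CompExact q.data q.stage q.dom w ∧ ExactIn VisibleToCircuit q.data q.stage q.dom v' ∧
    CompSim w π v'

theorem bulletList_eq_some_iff {π : CircuitInput} {l : List Comp} {L : List MVal} :
    bulletList π l = some L ↔ List.Forall₂ (fun w u => bullet π w.1 w.2 = some u) l L := by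
  induction l generalizing L with
  | nil => simp [bulletList, eq_comm]
  | cons w l ih =>
    obtain ⟨v, c⟩ := w
    simp only [bulletList, Option.bind_eq_bind, Option.bind_eq_some_iff, Option.some.injEq,
      List.forall₂_cons_left_iff]
    constructor
    · rintro ⟨u, hu, L', hL, rfl⟩
      exact ⟨u, L', hu, ih.1 hL, rfl⟩
    · rintro ⟨u, L', hu, hL, rfl⟩
      exact ⟨u, hu, L', ih.2 hL, rfl⟩

theorem compSim_list_iff {π : CircuitInput} {l : List Comp} {c : Option Circuit} {l' : List MVal} :
    CompSim (.list l, c) π (.list l') ↔ List.Forall₂ (fun w v' => CompSim w π v') l l' := by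
  simp only [CompSim, bullet, Option.bind_eq_bind, Option.bind_eq_some_iff, Option.some.injEq,
    bulletList_eq_some_iff]
  constructor
  · rintro ⟨_, ⟨L, hL, rfl⟩, h⟩
    cases h with
    | list h =>
      induction hL generalizing l' with
      | nil => cases h; exact .nil
      | cons hu _ ih =>
        cases h with
        | cons hs h => exact .cons ⟨_, hu, hs⟩ (ih h)
  · intro h
    suffices ∃ L, List.Forall₂ (fun w u => bullet π w.1 w.2 = some u) l L ∧
        List.Forall₂ Sim L l' by
      obtain ⟨L, h₁, h₂⟩ := this
      exact ⟨_, ⟨L, h₁, rfl⟩, .list h₂⟩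
    induction h with
    | nil => exact ⟨[], .nil, .nil⟩
    | cons hu _ ih =>
      obtain ⟨L, h₁, h₂⟩ := ih
      obtain ⟨u, hu, hs⟩ := hu
      exact ⟨u :: L, .cons hu h₁, .cons hs h₂⟩

/-- Well-structured list types have stage `pre`, so this and `valRel_hidden_iff` cover all of them.
-/
theorem valRel_list_pub_iff {π : CircuitInput} {t : DataType} {s : Stage} {d : Domain} {w : Comp}
    {v' : MVal} :
    ValRel π ⟨.list t s d, .pre, .pub⟩ w v' ↔
      ∃ l l', w = (.list l, none) ∧ v' = .list l' ∧ List.Forall₂ (ValRel π ⟨t, s, d⟩) l l' := by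
  obtain ⟨v, c⟩ := w
  simp only [ValRel, CompExact, ExactIn, StageExact, VisibleToCircuit]
  constructor
  · rintro ⟨⟨⟨-, hc⟩, hw, -⟩, hv', hs⟩
    obtain ⟨l, rfl, hl⟩ := hw trivial
    replace hc := hc trivial
    obtain ⟨-, l', rfl, hl'⟩ | ⟨h, -⟩ := hv'
    · obtain rfl : c = none := hc
      refine ⟨l, l', rfl, rfl, ?_⟩
      rw [compSim_list_iff] at hs
      clear * - hs hl hl'
      induction hs with
      | nil => exact .nil
      | cons h _ ih =>
        simp only [List.mem_cons, forall_eq_or_imp] at hl hl'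
        exact .cons ⟨hl.1, hl'.1, h⟩ (ih hl.2 hl'.2)
    · simp at h
  · rintro ⟨l, l', h, rfl, hl⟩
    cases h
    refine ⟨⟨⟨by simp, by simp⟩, fun _ => ⟨l, rfl, ?_⟩, by simp⟩,
      .inl ⟨by simp, l', rfl, ?_⟩, ?_⟩
    · intro w hw
      induction hl with
      | nil => simp at hw
      | cons h _ ih =>
        rcases List.mem_cons.1 hw with rfl | hw
        exacts [h.1, ih hw]
    · intro w hw
      induction hl with
      | nil => simp at hw
      | cons h _ ih =>
        rcases List.mem_cons.1 hw with rfl | hw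
        exacts [h.2.1, ih hw]
    · exact compSim_list_iff.2 (hl.imp fun _ _ h => h.2.2)

/-- No data type matters here. This makes `⊤` a correct result whenever an unknown guard, bound or
index stops an evaluation. -/
theorem valRel_hidden_iff {π : CircuitInput} {t : DataType} {d : Domain} (hd : d ≠ .pub)
    {w : Comp} {v' : MVal} :
    ValRel π ⟨t, .pre, d⟩ w v' ↔ w = (.top, none) ∧ v' = .top := by
  obtain ⟨v, c⟩ := w
  have key : CompSim (.top, none) π .top := ⟨.top, by simp [bullet], .top⟩
  cases t <;>
  · simp only [ValRel, CompExact, ExactIn, StageExact, VisibleToCircuit, hd]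
    constructor
    · rintro ⟨⟨⟨-, hc⟩, -, hv⟩, hv', -⟩
      have hc := hc trivial
      have hv := hv hd
      simp_all
    · rintro ⟨h, rfl⟩
      cases h
      simpa using key

theorem valRel_unit_iff {π : CircuitInput} {w : Comp} {v' : MVal} :
    ValRel π ⟨.unit, .pre, .pub⟩ w v' ↔ w = (.unit, none) ∧ v' = .unit := by
  obtain ⟨v, c⟩ := w
  have key : CompSim (.unit, none) π .unit := ⟨.unit, by simp [bullet], .unit⟩
  simp only [ValRel, CompExact, ExactIn, StageExact, VisibleToCircuit]
  constructor
  · rintro ⟨⟨⟨-, hc⟩, h, -⟩, h' | h', -⟩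
    · have h := h trivial
      have h' := h'.2
      have hc := hc trivial
      cases v <;> cases v' <;> simp_all [CVal.HasPrim, MVal.HasPrim]
    · simp at h'
  · rintro ⟨h, rfl⟩
    cases h
    simpa [CVal.HasPrim, MVal.HasPrim] using key

-- Constant circuits and the value relation at primitive types.

/-- The circuit `c` has the value `n` on every input. -/
def ConstCircuit (c : Circuit) (n : ℕ) : Prop :=
  c.closedValue = some n ∧ ∀ π, c.closedValue = c.value π

theorem constCircuit_con (n : ℕ) : ConstCircuit (.con n) n := ⟨rfl, fun _ => rfl⟩

theorem ConstCircuit.value {c : Circuit} {n : ℕ} (h : ConstCircuit c n) (π : CircuitInput) :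
    c.value π = some n := (h.2 π).symm.trans h.1

theorem ConstCircuit.add {c₁ c₂ : Circuit} {n₁ n₂ : ℕ} (h₁ : ConstCircuit c₁ n₁)
    (h₂ : ConstCircuit c₂ n₂) (N : ℕ+) :
    ConstCircuit (.op .add N c₁ c₂) ((n₁ + n₂) % (N : ℕ)) := by
  refine ⟨by simp [Circuit.closedValue, h₁.1, h₂.1, CircuitOp.apply], fun π => ?_⟩
  simp [Circuit.closedValue, Circuit.value, h₁.1, h₂.1, h₁.value π, h₂.value π]

theorem sim_nat_nat_iff {m n : ℕ} : Sim (.nat m) (.nat n) ↔ m = n :=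
  ⟨fun h => by cases h; rfl, fun h => h ▸ .nat _⟩

theorem sim_top_top : Sim .top .top := .top

theorem code_injective : Function.Injective code := by
  intro a b; cases a <;> cases b <;> simp [code]

theorem sim_nat_bool_iff {n : ℕ} {b : Bool} : Sim (.nat n) (.bool b) ↔ n = code b :=
  ⟨fun h => by cases h; rfl, fun h => h ▸ .natBool _⟩

/-- The cases are: hidden, public before the circuit, public with a constant circuit, and known only
through the circuit. `Sim` disappears because exactness already makes a known `v'` a number. -/
theorem valRel_uint_iff {π : CircuitInput} {m : Option ℕ+} {s : Stage} {d : Domain} {w : Comp}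
    {v' : MVal} :
    ValRel π ⟨.uint m, s, d⟩ w v' ↔
      (s = .pre ∧ d ≠ .pub ∧ w = (.top, none) ∧ v' = .top) ∨
      ∃ n, v' = .nat n ∧
        ((s = .pre ∧ d = .pub ∧ w = (.nat n, none)) ∨
        ∃ c, s = .post ∧ ((d = .pub ∧ w = (.nat n, some c) ∧ ConstCircuit c n) ∨
          (d ≠ .pub ∧ w = (.top, some c) ∧ c.value π = some n))) := by
  obtain ⟨v, c⟩ := w
  simp only [ValRel, CompExact, ExactIn, StageExact, VisibleToCircuit, CompSim]
  by_cases hd : d = .pub <;> cases s <;> cases c <;> cases v <;> cases v' <;>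
    simp [hd, CVal.HasPrim, MVal.HasPrim, bullet, Option.bind_eq_some_iff, sim_nat_nat_iff,
      sim_top_top, ConstCircuit]
  all_goals grind

/-- The correspondence sees only the code of a Boolean; exactness and the injectivity of `code`
recover the Boolean itself. -/
theorem valRel_bool_iff {π : CircuitInput} {m : Option ℕ+} {s : Stage} {d : Domain} {w : Comp}
    {v' : MVal} :
    ValRel π ⟨.bool m, s, d⟩ w v' ↔
      (s = .pre ∧ d ≠ .pub ∧ w = (.top, none) ∧ v' = .top) ∨
      ∃ b, v' = .bool b ∧
        ((s = .pre ∧ d = .pub ∧ w = (.bool b, none)) ∨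
        ∃ c, s = .post ∧ ((d = .pub ∧ w = (.bool b, some c) ∧ ConstCircuit c (code b)) ∨
          (d ≠ .pub ∧ w = (.top, some c) ∧ c.value π = some (code b)))) := by
  obtain ⟨v, c⟩ := w
  simp only [ValRel, CompExact, ExactIn, StageExact, VisibleToCircuit, CompSim]
  by_cases hd : d = .pub <;> cases s <;> cases c <;> cases v <;> cases v' <;>
    simp [hd, CVal.HasPrim, MVal.HasPrim, bullet, Option.bind_eq_some_iff, sim_nat_bool_iff,
      sim_top_top, ConstCircuit, code_injective.eq_iff]
  all_goals grind

/-! ## Related environments -/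

/-- Pointwise related environments for the associations `T`. The Boolean flags in `M` tell at which
positions the values have to correspond; at the other positions, they only have to be exact and
defined. -/
inductive EnvRel (π : CircuitInput) : Assoc QType → Assoc Bool → CEnv → Env → Prop
  | nil : EnvRel π [] [] [] []
  | cons {x : Var} {q : QType} {b : Bool} {w : Comp} {u v' : MVal} {T : Assoc QType}
      {M : Assoc Bool} {γ : CEnv} {γ' : Env}
      (hw : CompExact q.data q.stage q.dom w)
      (hv : ExactIn VisibleToCircuit q.data q.stage q.dom v')
      (hu : bullet π w.1 w.2 = some u) (hs : b = true → Sim u v') (h : EnvRel π T M γ γ') :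
      EnvRel π ((x, q) :: T) ((x, b) :: M) ((x, w) :: γ) ((x, v') :: γ')

/-- The first flag of every variable is set. -/
def Covers (M : Assoc Bool) : Prop := ∀ x b, Assoc.find M x = some b → b = true

theorem Covers.cons {M : Assoc Bool} (h : Covers M) (x : Var) : Covers ((x, true) :: M) := by
  intro y b hb
  simp only [Assoc.find] at hb
  split at hb
  · simpa using hb.symm
  · exact h y b hb

theorem EnvRel.push {π : CircuitInput} {T : Assoc QType} {M : Assoc Bool} {γ : CEnv} {γ' : Env}
    (h : EnvRel π T M γ γ') (x : Var) {q : QType} {w : Comp} {v' : MVal} (hw : ValRel π q w v') :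
    EnvRel π ((x, q) :: T) ((x, true) :: M) ((x, w) :: γ) ((x, v') :: γ') := by
  obtain ⟨h₁, h₂, u, hu, hs⟩ := hw
  exact .cons h₁ h₂ hu (fun _ => hs) h

/-- The flags never change while an expression is evaluated, so leaving a scope restores those with
which it was entered, also for a shadowed variable that becomes visible again. -/
theorem EnvRel.pop {π : CircuitInput} {a : Var × QType} {b : Var × Bool} {T : Assoc QType}
    {M : Assoc Bool} {γ : CEnv} {γ' : Env} (h : EnvRel π (a :: T) (b :: M) γ γ') :
    EnvRel π T M γ.tail γ'.tail := by
  cases h with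
  | cons _ _ _ _ h => exact h

/-- The condition on the flags concerns `x` alone: `Covers` does not pass to tails, where shadowed
associations come first, but this condition does as long as `x` has not been met. -/
theorem EnvRel.find {π : CircuitInput} {T : Assoc QType} {M : Assoc Bool} {γ : CEnv} {γ' : Env}
    (h : EnvRel π T M γ γ') {x : Var} {q : QType} (hx : Assoc.find T x = some q)
    (hM : ∀ b, Assoc.find M x = some b → b = true) :
    ∃ w v', Assoc.find γ x = some w ∧ Assoc.find γ' x = some v' ∧ ValRel π q w v' := by
  induction h with
  | nil => simp [Assoc.find] at hx
  | @cons y q' b w u v' T M γ γ' hw hv hu hs h ih =>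
    by_cases hy : y = x
    · simp only [Assoc.find, hy, if_true, Option.some.injEq] at hx hM ⊢
      subst hx
      exact ⟨w, v', rfl, rfl, hw, hv, u, hu, hs (hM b rfl)⟩
    · simp only [Assoc.find, hy, if_false] at hx hM ⊢
      exact ih hx hM

theorem EnvRel.update {π : CircuitInput} {T : Assoc QType} {M : Assoc Bool} {γ : CEnv} {γ' : Env}
    (h : EnvRel π T M γ γ') {x : Var} {q : QType} (hx : Assoc.find T x = some q) {w : Comp}
    {v' : MVal} (hw : ValRel π q w v') :
    EnvRel π T M (Assoc.update γ x w) (Assoc.update γ' x v') := by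
  induction h with
  | nil => exact .nil
  | @cons y q' b w₀ u v₀' T M γ γ' hw₀ hv hu hs h ih =>
    by_cases hy : y = x
    · simp only [Assoc.find, Assoc.update, hy, if_true, Option.some.injEq] at hx ⊢
      subst hx
      obtain ⟨h₁, h₂, u, hu, hs⟩ := hw
      exact .cons h₁ h₂ hu (fun _ => hs) h
    · simp only [Assoc.find, Assoc.update, hy, if_false] at hx ⊢
      exact .cons hw₀ hv hu hs (ih hx)

theorem EnvRel.cEnvSim {π : CircuitInput} {T : Assoc QType} {M : Assoc Bool} {γ : CEnv} {γ' : Env}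
    (h : EnvRel π T M γ γ') (hM : Covers M) : CEnvSim γ π γ' := by
  -- `Covers` is not inherited by the tail; the flag of the variable looked up replaces it in the
  -- induction.
  suffices ∃ δ, bulletEnv π γ = some δ ∧ δ.map Prod.fst = γ'.map Prod.fst ∧
      ∀ x v v', Assoc.find δ x = some v → Assoc.find γ' x = some v' →
        Assoc.find M x = some true → Sim v v' by
    obtain ⟨δ, h₁, h₂, h₃⟩ := this
    refine ⟨δ, h₁, h₂, fun x v v' hv hv' => h₃ x v v' hv hv' ?_⟩
    have hx : ∃ b, Assoc.find M x = some b := by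
      clear h₁ h₂ h₃ hM hv
      induction h with
      | nil => simp [Assoc.find] at hv'
      | cons _ _ _ _ _ ih =>
        simp only [Assoc.find] at hv' ⊢
        split_ifs at hv' ⊢
        exacts [⟨_, rfl⟩, ih hv']
    obtain ⟨b, hb⟩ := hx
    rwa [hM x b hb] at hb
  clear hM
  induction h with
  | nil => exact ⟨[], rfl, rfl, by simp [Assoc.find]⟩
  | @cons y q' b w u v' T M γ γ' hw hv hu hs h ih =>
    obtain ⟨δ, h₁, h₂, h₃⟩ := ih
    refine ⟨(y, u) :: δ, by simp [bulletEnv, hu, h₁], by simp [h₂], fun x a a' ha ha' hb => ?_⟩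
    simp only [Assoc.find] at ha ha' hb
    split_ifs at ha ha' hb
    · cases ha; cases ha'; cases hb
      exact hs rfl
    · exact h₃ x a a' ha ha' hb

/-- Nothing is assumed about correspondence at shadowed positions, so each flag is chosen as the
truth value of `Sim` at its position. At first associations it is then true by hypothesis. -/
theorem exists_envRel {π : CircuitInput} {Γ : TyEnv} {γ : CEnv} {γ' : Env} (hγ : CEnvExact Γ γ)
    (hγ' : ExactInCircuit Γ γ') (h : CEnvSim γ π γ') :
    ∃ M, Covers M ∧ EnvRel π Γ.typings M γ γ' := by
  classical
  obtain ⟨δ, hδ, -, hs⟩ := h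
  -- The hypothesis on `Sim` fails to restrict to tails; as a premise inside the conclusion it no
  -- longer obstructs the induction.
  suffices ∃ M, EnvRel π Γ.typings M γ γ' ∧ ∀ x b, Assoc.find M x = some b →
      ∃ v v', Assoc.find δ x = some v ∧ Assoc.find γ' x = some v' ∧ (Sim v v' → b = true) by
    obtain ⟨M, h₁, h₂⟩ := this
    refine ⟨M, fun x b hb => ?_, h₁⟩
    obtain ⟨v, v', hv, hv', h⟩ := h₂ x b hb
    exact h (hs x v v' hv hv')
  clear hs
  unfold CEnvExact at hγ
  unfold ExactInCircuit at hγ'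
  generalize Γ.typings = T at hγ hγ'
  induction hγ generalizing δ γ' with
  | nil =>
    cases hγ'
    exact ⟨[], .nil, by simp [Assoc.find]⟩
  | @cons a w T γ hw _ ih =>
    cases hγ' with
    | @cons _ v' _ γ' hv' hγ' =>
      obtain ⟨x, q⟩ := a
      obtain ⟨_, v, c⟩ := w
      obtain ⟨_, v'⟩ := v'
      obtain ⟨rfl, hw⟩ := hw
      obtain ⟨rfl, hv'⟩ := hv'
      simp only [bulletEnv, Option.bind_eq_bind, Option.bind_eq_some_iff, Option.some.injEq] at hδ
      obtain ⟨u, hu, δ, hδ, rfl⟩ := hδ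
      obtain ⟨M, h₁, h₂⟩ := ih δ hδ hγ'
      refine ⟨(x, decide (Sim u v')) :: M, .cons hw hv' hu (by simp) h₁, fun y b hb => ?_⟩
      simp only [Assoc.find] at hb ⊢
      split_ifs at hb ⊢
      · cases hb
        exact ⟨u, v', rfl, rfl, by simp⟩
      · exact h₂ y b hb

/-! ## Simulation -/

/-- The outcome `r'` of the circuit semantics, started with the streams `ω`, is simulated by the
outcome `r` of compilation, started with the counter `ν`. -/
def Simulated {A B : Type} (π : CircuitInput) (R : A → B → Prop) (T : Assoc QType)
    (M : Assoc Bool) (ν : Counter) (ω : Streams)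
    (r : A × CEnv × List Circuit × Counter × List InputNode) (r' : Option (B × Env × Streams)) :
    Prop :=
  TypeCorrectStreams r.2.2.2.2 ν ω →
    (∀ b γ' ω', r' = some (b, γ', ω') →
      R r.1 b ∧ EnvRel π T M r.2.1 γ' ∧ Accepts r.2.2.1 π ∧
      StreamSim (bulletCounter r.2.2.2.1 π) ω' ∧
      ∀ p, ν p ≤ r.2.2.2.1 p ∧ ω' p = (ω p).drop (r.2.2.2.1 p - ν p)) ∧
    (r' = none → InputsAvailable r.2.2.2.2 π → ¬ Accepts r.2.2.1 π)

theorem Simulated.pure {A B : Type} {π : CircuitInput} {R : A → B → Prop} {T : Assoc QType}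
    {M : Assoc Bool} {ν : Counter} {ω : Streams} {a : A} {b : B} {γ : CEnv} {γ' : Env}
    (hR : R a b) (hγ : EnvRel π T M γ γ') (hω : StreamSim (bulletCounter ν π) ω) :
    Simulated π R T M ν ω (a, γ, [], ν, []) (some (b, γ', ω)) := by
  refine fun _ => ⟨?_, by simp⟩
  rintro _ _ _ h
  cases h
  exact ⟨hR, hγ, by simp [Accepts], hω, by simp⟩

/-- Accepting `o₁ ++ o₂` means accepting both lists, so a failure in the first evaluation already
refutes acceptance, whatever was compiled afterwards. -/
theorem Simulated.bind {A A₂ B B₂ : Type} {π : CircuitInput} {R : A → B → Prop}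
    {R₂ : A₂ → B₂ → Prop} {T T₂ : Assoc QType} {M M₂ : Assoc Bool} {ν ν₁ ν₂ : Counter}
    {ω : Streams} {a₁ : A} {a₂ : A₂} {γ₁ γ₂ : CEnv} {o₁ o₂ : List Circuit} {ι₁ ι₂ : List InputNode}
    {r' : Option (B × Env × Streams)} {f : B × Env × Streams → Option (B₂ × Env × Streams)}
    (h₁ : Simulated π R T M ν ω (a₁, γ₁, o₁, ν₁, ι₁) r')
    (h₂ : ∀ b γ' ω', R a₁ b → EnvRel π T M γ₁ γ' → StreamSim (bulletCounter ν₁ π) ω' →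
      Simulated π R₂ T₂ M₂ ν₁ ω' (a₂, γ₂, o₂, ν₂, ι₂) (f (b, γ', ω'))) :
    Simulated π R₂ T₂ M₂ ν ω (a₂, γ₂, o₁ ++ o₂, ν₂, ι₁ ++ ι₂) (r'.bind f) := by
  intro hι
  have hι₁ : TypeCorrectStreams ι₁ ν ω := fun i hi => hι i (List.mem_append_left _ hi)
  obtain ⟨h₁s, h₁n⟩ := h₁ hι₁
  rcases r' with _ | ⟨b, γ', ω'⟩
  · refine ⟨by simp, fun _ hav hacc => h₁n rfl (fun i hi => hav i (List.mem_append_left _ hi))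
      fun c hc => hacc c (List.mem_append_left _ hc)⟩
  · obtain ⟨hR, hγ, ho, hω, hν⟩ := h₁s b γ' ω' rfl
    -- The first evaluation has removed `ν₁ - ν` entries, so the entry with index `k - ν₁` in the
    -- remaining stream is the one with index `k - ν` in the original stream.
    have hι₂ : TypeCorrectStreams ι₂ ν₁ ω' := by
      intro i hi v hle hv
      obtain ⟨h, hω'⟩ := hν i.party
      refine hι i (List.mem_append_right _ hi) v (h.trans hle) ?_
      simp only at hω'
      rw [hω', List.getElem?_drop] at hv
      rw [← hv]
      congr 1
      simp only at h
      omega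
    obtain ⟨h₂s, h₂n⟩ := h₂ b γ' ω' hR hγ hω hι₂
    refine ⟨fun b₂ γ₂' ω₂' h => ?_, fun h hav hacc => ?_⟩
    · obtain ⟨hR₂, hγ₂, ho₂, hω₂, hν₂⟩ := h₂s b₂ γ₂' ω₂' h
      refine ⟨hR₂, hγ₂, fun c hc => ?_, hω₂, fun p => ?_⟩
      · rcases List.mem_append.1 hc with hc | hc
        exacts [ho c hc, ho₂ c hc]
      · obtain ⟨h₁, h₁'⟩ := hν p
        obtain ⟨h₂, h₂'⟩ := hν₂ p
        simp only at h₁ h₁' h₂ h₂' ⊢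
        refine ⟨h₁.trans h₂, ?_⟩
        rw [h₂', h₁', List.drop_drop]
        congr 1
        omega
    · exact h₂n h (fun i hi => hav i (List.mem_append_right _ hi))
        fun c hc => hacc c (List.mem_append_right _ hc)

/-- The variant of `Simulated.bind` for a continuation without outputs. -/
theorem Simulated.map {A A₂ B B₂ : Type} {π : CircuitInput} {R : A → B → Prop}
    {R₂ : A₂ → B₂ → Prop} {T T₂ : Assoc QType} {M M₂ : Assoc Bool} {ν ν₁ ν₂ : Counter}
    {ω : Streams} {a₁ : A} {a₂ : A₂} {γ₁ γ₂ : CEnv} {o₁ : List Circuit} {ι₁ : List InputNode}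
    {r' : Option (B × Env × Streams)} {f : B × Env × Streams → Option (B₂ × Env × Streams)}
    (h₁ : Simulated π R T M ν ω (a₁, γ₁, o₁, ν₁, ι₁) r')
    (h₂ : ∀ b γ' ω', R a₁ b → EnvRel π T M γ₁ γ' → StreamSim (bulletCounter ν₁ π) ω' →
      Simulated π R₂ T₂ M₂ ν₁ ω' (a₂, γ₂, [], ν₂, []) (f (b, γ', ω'))) :
    Simulated π R₂ T₂ M₂ ν ω (a₂, γ₂, o₁, ν₂, ι₁) (r'.bind f) := by
  simpa using h₁.bind h₂

/-! ## Domains and types -/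

theorem Domain.le_pub_iff {d : Domain} : d ≤ .pub ↔ d = .pub := by
  change d.rank ≤ Domain.rank .pub ↔ _
  cases d <;> simp [Domain.rank]

theorem Domain.pub_mem_up_iff {d : Domain} : Domain.pub ∈ d.up ↔ d = .pub :=
  Domain.le_pub_iff

theorem Stage.pub_mem_up_iff {s : Stage} : Domain.pub ∈ s.up ↔ s = .post := by
  cases s <;> simp [Stage.up, Domain.pub_mem_up_iff]

/-- It suffices to test the inclusion at `pub`: stage `post` or domain `pub` would put it into the
left side, but only `d' = pub` has it on the right. -/
theorem hidden_of_up_subset {s : Stage} {d d' : Domain} (h : s.up ∪ d.up ⊆ d'.up)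
    (hd' : d' ≠ .pub) : s = .pre ∧ d ≠ .pub := by
  constructor
  · cases s
    · exact absurd (Domain.pub_mem_up_iff.1 (h (.inl (Stage.pub_mem_up_iff.2 rfl)))) hd'
    · rfl
  · intro hd
    exact hd' (Domain.pub_mem_up_iff.1 (h (.inr (Domain.pub_mem_up_iff.2 hd))))

theorem Stage.not_pre_le_post : ¬ Stage.pre ≤ Stage.post :=
  Nat.not_succ_le_zero 0

theorem Stage.eq_pre_of_pre_le {s : Stage} (h : Stage.pre ≤ s) : s = .pre := by
  cases s
  · exact absurd h Stage.not_pre_le_post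
  · rfl

theorem Domain.party_eq_none_iff {d : Domain} : d.party = none ↔ d = .pub := by
  cases d <;> simp [Domain.party]

theorem TyEnv.find_typings (Γ : TyEnv) (x : Var) :
    Assoc.find Γ.typings x = TyEnv.lookupType Γ x := by
  induction Γ with
  | nil => rfl
  | cons a Γ ih => cases a <;> simp [TyEnv.typings, TyEnv.lookupType, Assoc.find, ih]

theorem TyEnv.WellStructured.lookupType {Γ : TyEnv} (hΓ : Γ.WellStructured) {x : Var} {q : QType}
    (h : TyEnv.lookupType Γ x = some q) : ZKSC.WellStructured q.data q.stage q.dom := by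
  rw [← TyEnv.find_typings] at h
  unfold TyEnv.WellStructured at hΓ
  generalize Γ.typings = T at hΓ h
  induction T with
  | nil => simp [Assoc.find] at h
  | cons a T ih =>
    simp only [List.mem_cons, forall_eq_or_imp] at hΓ
    obtain ⟨y, q'⟩ := a
    simp only [Assoc.find] at h
    split_ifs at h
    · cases h
      exact hΓ.1
    · exact ih hΓ.2 h

theorem TyEnv.WellStructured.cons_typing {Γ : TyEnv} (hΓ : Γ.WellStructured) (x : Var) {q : QType}
    (hq : ZKSC.WellStructured q.data q.stage q.dom) : TyEnv.WellStructured (.typing x q :: Γ) := by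
  intro a ha
  rcases List.mem_cons.1 ha with rfl | ha
  exacts [hq, hΓ a ha]

theorem TyEnv.WellStructured.cons_mutability {Γ : TyEnv} (hΓ : Γ.WellStructured) (x : Var)
    (b : Bool) : TyEnv.WellStructured (.mutability x b :: Γ) :=
  hΓ

theorem wellStructured_of_allPre {d' : Domain} {t : DataType} {s : Stage} {d : Domain}
    (h : allPre d' t s d) : WellStructured t s d := by
  induction t generalizing s d with
  | list t₁ s₁ d₁ ih =>
    obtain ⟨rfl, rfl, h⟩ := h
    have h₁ : s₁ = .pre ∧ d₁ = d := by cases t₁ <;> simp_all [allPre]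
    obtain ⟨rfl, rfl⟩ := h₁
    exact ⟨rfl, by simp [Stage.up], ih h⟩
  | _ => simp_all [allPre, WellStructured]

/-- Loads and casts rely on this: the elements of a hidden list are hidden, and units and lists
never have stage `post`. The side conditions on loops and casts are what preserves it. -/
theorem HasType.wellStructured {Γ : TyEnv} {e : Expr} {q : QType} {D : Set Domain}
    (h : HasType Γ e q D) (hΓ : Γ.WellStructured) : WellStructured q.data q.stage q.dom := by
  induction h with
  | eps => rfl
  | natLit => trivial
  | boolLit => trivial
  | var h => exact hΓ.lookupType h
  | add => trivial
  | assertion => rfl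
  | get h => exact wellStructured_of_allPre h
  | cond _ _ _ _ _ ih _ => exact ih hΓ
  | @loop Γ x e₁ e₂ e₃ d' t s d D₁ D₂ D₃ _ _ _ hd _ _ ih =>
    exact ⟨rfl, Set.subset_union_left.trans hd, ih (hΓ.cons_typing _ trivial)⟩
  | wire ht _ _ => rcases ht with rfl | rfl <;> trivial
  | @cast Γ e t s d s' d' D _ hs hd ht ih =>
    have ih := ih hΓ
    cases t with
    | uint => trivial
    | bool => trivial
    | unit =>
      obtain rfl : s = .pre := ih
      exact Stage.eq_pre_of_pre_le hs
    | list t₁ s₁ d₁ =>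
      obtain ⟨rfl, -, h₁⟩ := ih
      refine ⟨Stage.eq_pre_of_pre_le hs, ?_, h₁⟩
      rw [DataType.up, Set.union_assoc] at ht
      exact Set.subset_union_right.trans ht
  | assign => rfl
  | load _ _ _ ih _ => exact (ih hΓ).2.2
  | letIn _ _ ih₁ ih₂ => exact ih₂ ((hΓ.cons_typing _ (ih₁ hΓ)).cons_mutability _ _)
  | seq _ _ _ ih => exact ih hΓ

/-! ## Operations on related values -/

theorem forall₂_getElem? {A B : Type} {R : A → B → Prop} {l : List A} {l' : List B}
    (h : List.Forall₂ R l l') {i : ℕ} {a : A} (ha : l[i]? = some a) :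
    ∃ b, l'[i]? = some b ∧ R a b := by
  induction h generalizing i with
  | nil => simp at ha
  | cons h _ ih =>
    cases i with
    | zero => simp at ha ⊢; exact ha ▸ h
    | succ i => simpa using ih (by simpa using ha)

theorem forall₂_set {A B : Type} {R : A → B → Prop} {l : List A} {l' : List B}
    (h : List.Forall₂ R l l') (i : ℕ) {a : A} {b : B} (hab : R a b) :
    List.Forall₂ R (l.set i a) (l'.set i b) := by
  induction h generalizing i with
  | nil => exact .nil
  | cons h hl ih =>
    cases i with
    | zero => exact .cons hab hl
    | succ i => exact .cons h (ih i)

theorem ValRel.uint_pre_pub {π : CircuitInput} {m : Option ℕ+} {w : Comp} {v' : MVal}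
    (h : ValRel π ⟨.uint m, .pre, .pub⟩ w v') : ∃ n, w = (.nat n, none) ∧ v' = .nat n := by
  rw [valRel_uint_iff] at h
  grind

theorem valRel_nat_pre_pub (π : CircuitInput) (m : Option ℕ+) (n : ℕ) :
    ValRel π ⟨.uint m, .pre, .pub⟩ (.nat n, none) (.nat n) :=
  valRel_uint_iff.2 (.inr ⟨n, rfl, .inl ⟨rfl, rfl, rfl⟩⟩)

theorem valRel_top (π : CircuitInput) (t : DataType) {d : Domain} (hd : d ≠ .pub) :
    ValRel π ⟨t, .pre, d⟩ (.top, none) .top :=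
  (valRel_hidden_iff hd).2 ⟨rfl, rfl⟩

theorem valRel_natLit (π : CircuitInput) (n : ℕ) (m : Option ℕ+) (s : Stage) (d : Domain) :
    ValRel π ⟨.uint m, s, d⟩
      (if d = .pub then .nat n else .top, if s = .post then some (.con n) else none)
      (if s = .post ∨ d = .pub then .nat n else .top) := by
  rw [valRel_uint_iff]
  by_cases hd : d = .pub <;> cases s <;> simp [hd, constCircuit_con, Circuit.value]

theorem valRel_boolLit (π : CircuitInput) (b : Bool) (m : Option ℕ+) (s : Stage) (d : Domain) :
    ValRel π ⟨.bool m, s, d⟩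
      (if d = .pub then .bool b else .top, if s = .post then some (.con (code b)) else none)
      (if s = .post ∨ d = .pub then .bool b else .top) := by
  rw [valRel_bool_iff]
  by_cases hd : d = .pub <;> cases s <;> simp [hd, constCircuit_con, Circuit.value]

/-- The summands share stage and domain, so they fall into the same case of `valRel_uint_iff`, and
every case is closed under addition. -/
theorem ValRel.add {π : CircuitInput} {m : Option ℕ+} {s : Stage} {d : Domain}
    (hm : m = none → s = .pre) {v₁ v₂ v : CVal} {c₁ c₂ : Option Circuit} {v₁' v₂' : MVal}
    (h₁ : ValRel π ⟨.uint m, s, d⟩ (v₁, c₁) v₁') (h₂ : ValRel π ⟨.uint m, s, d⟩ (v₂, c₂) v₂')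
    (h : CVal.add m v₁ v₂ = some v) :
    ∃ v', MVal.add m v₁' v₂' = some v' ∧
      ValRel π ⟨.uint m, s, d⟩ (v, addCircuit m c₁ c₂) v' := by
  simp only [valRel_uint_iff, Prod.mk.injEq] at h₁ h₂ ⊢
  obtain ⟨rfl, hd, ⟨rfl, rfl⟩, rfl⟩ | ⟨n₁, rfl, h₁⟩ := h₁
  · simp only [CVal.add, Option.some.injEq] at h
    exact ⟨.top, by simp [MVal.add], .inl ⟨rfl, hd, ⟨h.symm, by cases m <;> rfl⟩, rfl⟩⟩
  obtain ⟨rfl, hd, ⟨rfl, rfl⟩, rfl⟩ | ⟨n₂, rfl, h₂⟩ := h₂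
  · grind
  refine ⟨_, rfl, .inr ⟨_, rfl, ?_⟩⟩
  obtain ⟨rfl, rfl, rfl, rfl⟩ | ⟨c₁, rfl, h₁⟩ := h₁
  · obtain ⟨-, -, rfl, rfl⟩ | ⟨c₂, h, -⟩ := h₂
    · simp only [CVal.add, Option.some.injEq] at h
      exact .inl ⟨rfl, rfl, h.symm, by cases m <;> rfl⟩
    · cases h
  · obtain ⟨h, -⟩ | ⟨c₂, -, h₂⟩ := h₂
    · cases h
    obtain _ | N := m
    · cases hm rfl
    obtain ⟨rfl, ⟨rfl, rfl⟩, h₁⟩ | ⟨hd, ⟨rfl, rfl⟩, h₁⟩ := h₁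
    · obtain ⟨-, ⟨rfl, rfl⟩, h₂⟩ | ⟨h, -⟩ := h₂
      · simp only [CVal.add, Option.some.injEq] at h
        exact .inr ⟨_, rfl, .inl ⟨rfl, ⟨h.symm, rfl⟩, h₁.add h₂ N⟩⟩
      · exact absurd rfl h
    · obtain ⟨h, -⟩ | ⟨-, ⟨rfl, rfl⟩, h₂⟩ := h₂
      · exact absurd h hd
      · simp only [CVal.add, Option.some.injEq] at h
        exact .inr ⟨_, rfl, .inr ⟨hd, ⟨h.symm, rfl⟩,
          by simp [Circuit.value, h₁, h₂, CircuitOp.apply, reduce]⟩⟩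

/-- A cast can only forget: the circuit when the stage becomes `pre`, the known value when the
domain becomes non-public. In the latter case with stage `post` the remaining circuit still yields
the value, since the circuit of a known value is constant. -/
theorem ValRel.cast {π : CircuitInput} {t : DataType} {s s' : Stage} {d d' : Domain}
    (ht : WellStructured t s d) (hs : s ≤ s') (hd : d ≤ d') {v : CVal} {c : Option Circuit}
    {v' : MVal} (h : ValRel π ⟨t, s, d⟩ (v, c) v') :
    ValRel π ⟨t, s', d'⟩ (if d' = .pub then v else .top, if s' = .post then c else none)
      (if s' = .post ∨ d' = .pub then v' else .top) := by
  by_cases hd' : d' = .pub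
  · subst hd'
    obtain rfl := Domain.le_pub_iff.1 hd
    cases s' with
    | post =>
      cases s with
      | post => simpa using h
      | pre => exact absurd hs Stage.not_pre_le_post
    | pre =>
      cases s with
      | pre =>
        have hc : c = none := by cases t <;> exact h.1.1.2 rfl
        simpa [hc] using h
      | post =>
        cases t with
        | uint m =>
          rw [valRel_uint_iff] at h ⊢
          grind
        | bool m =>
          rw [valRel_bool_iff] at h ⊢
          grind
        | unit => cases ht
        | list => cases ht.1
  · cases s' with
    | pre => simpa [hd'] using valRel_top π t hd'
    | post =>
      cases s with
      | pre => exact absurd hs Stage.not_pre_le_post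
      | post =>
        cases t with
        | uint m =>
          rw [valRel_uint_iff] at h ⊢
          have := @ConstCircuit.value
          grind
        | bool m =>
          rw [valRel_bool_iff] at h ⊢
          have := @ConstCircuit.value
          grind
        | unit => cases ht
        | list => cases ht.1

theorem allPureList_eq_map (l : List Core) : Core.allPureList l = l.map Core.allPure := by
  induction l with
  | nil => rfl
  | cons u l ih => simp [Core.allPureList, ih]

theorem allPureTopList_eq_map (l : List Core) :
    Core.allPureTopList l = l.map Core.allPureTop := by
  induction l with
  | nil => rfl
  | cons u l ih => simp [Core.allPureTopList, ih]

theorem valRel_allPure (π : CircuitInput) {t : DataType} {s : Stage} {d : Domain}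
    (ht : allPre .pub t s d) {u : Core} (hu : ExactIn (fun q => q.dom ≤ .pub) t s d u.allPure) :
    ValRel π ⟨t, s, d⟩ u.allPureTop u.allPure := by
  have hle : Domain.pub ≤ Domain.pub := le_refl (α := ℕ) _
  induction t generalizing s d u with
  | uint m =>
    obtain ⟨rfl, rfl⟩ := ht
    rw [valRel_uint_iff]
    cases u <;> simp_all [ExactIn, Core.allPure, Core.allPureTop, MVal.HasPrim]
  | bool m =>
    obtain ⟨rfl, rfl⟩ := ht
    rw [valRel_bool_iff]
    cases u <;> simp_all [ExactIn, Core.allPure, Core.allPureTop, MVal.HasPrim]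
  | unit =>
    obtain ⟨rfl, rfl⟩ := ht
    rw [valRel_unit_iff]
    cases u <;> simp_all [ExactIn, Core.allPure, Core.allPureTop, MVal.HasPrim]
  | list t₁ s₁ d₁ ih =>
    obtain ⟨rfl, rfl, ht⟩ := ht
    rw [valRel_list_pub_iff]
    obtain ⟨-, l', hl', hl⟩ | ⟨h, -⟩ := hu
    · cases u with
      | list l =>
        simp only [Core.allPure, MVal.list.injEq] at hl'
        subst hl'
        refine ⟨_, _, by rw [Core.allPureTop], by rw [Core.allPure], ?_⟩
        rw [allPureList_eq_map] at hl ⊢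
        rw [allPureTopList_eq_map, List.forall₂_map_left_iff, List.forall₂_map_right_iff,
          List.forall₂_same]
        exact fun u hu => ih ht (hl _ (List.mem_map_of_mem hu))
      | _ => simp [Core.allPure] at hl'
    · exact absurd hle h

/-- In a public list both sides read the same position. A hidden list is `⊤` on both sides, and by
well-structuredness its elements are hidden too, so the result `⊤` has the right type. -/
theorem ValRel.index {π : CircuitInput} {t : DataType} {s s' : Stage} {d d' : Domain}
    (ht : WellStructured (.list t s d) s' d') {a w : Comp} {a' i' : MVal} {i : CVal}
    {c : Option Circuit} (ha : ValRel π ⟨.list t s d, s', d'⟩ a a')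
    (hi : ValRel π ⟨.uint none, s', d'⟩ (i, c) i') (h : CVal.index a.1 i = some w) :
    ∃ w', MVal.index a' i' = some w' ∧ ValRel π ⟨t, s, d⟩ w w' := by
  obtain ⟨rfl, hsd, ht⟩ := ht
  by_cases hd : d' = .pub
  · subst hd
    obtain ⟨l, l', rfl, rfl, hl⟩ := valRel_list_pub_iff.1 ha
    obtain ⟨n, hn, rfl⟩ := hi.uint_pre_pub
    cases hn
    exact forall₂_getElem? hl h
  · obtain ⟨rfl, rfl⟩ := (valRel_hidden_iff hd).1 ha
    obtain ⟨rfl, hd₁⟩ := hidden_of_up_subset hsd hd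
    cases h
    exact ⟨.top, rfl, valRel_top π t hd₁⟩

/-- Related index lists, which lead from the type `q₀` of a variable to the type `q` of a part. -/
inductive PathRel (π : CircuitInput) : QType → List CVal → List MVal → QType → Prop
  | nil {q : QType} : PathRel π q [] [] q
  | cons {t : DataType} {s s' : Stage} {d d' : Domain} {i : CVal} {c : Option Circuit} {i' : MVal}
      {is : List CVal} {is' : List MVal} {q : QType}
      (hi : ValRel π ⟨.uint none, s', d'⟩ (i, c) i') (h : PathRel π ⟨t, s, d⟩ is is' q) :
      PathRel π ⟨.list t s d, s', d'⟩ (i :: is) (i' :: is') q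

/-- The indices of an L-value are collected by appending, whereas updates consume them from the
front. -/
theorem PathRel.concat {π : CircuitInput} {t : DataType} {s s' : Stage} {d d' : Domain} {q : QType}
    {is : List CVal} {is' : List MVal} (h : PathRel π q is is' ⟨.list t s d, s', d'⟩) {i : CVal}
    {c : Option Circuit} {i' : MVal} (hi : ValRel π ⟨.uint none, s', d'⟩ (i, c) i') :
    PathRel π q (is ++ [i]) (is' ++ [i']) ⟨t, s, d⟩ := by
  generalize hq : QType.mk (.list t s d) s' d' = q' at h
  induction h with
  | nil => subst hq; exact .cons hi .nil
  | cons hj _ ih => exact .cons hj (ih hq)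

/-- Through public lists both updates descend at the same index. The first hidden list on the path
is replaced by `⊤` on both sides, whatever the remaining indices are. -/
theorem PathRel.upd {π : CircuitInput} {q₀ q : QType} {is : List CVal} {is' : List MVal}
    (h : PathRel π q₀ is is' q) (hq₀ : WellStructured q₀.data q₀.stage q₀.dom) {a w r : Comp}
    {a' w' : MVal} (ha : ValRel π q₀ a a') (hw : ValRel π q w w') (hr : updC a is w = some r) :
    ∃ r', MVal.upd a' is' w' = some r' ∧ ValRel π q₀ r r' := by
  induction h generalizing a a' r with
  | nil =>
    simp only [updC, Option.some.injEq] at hr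
    exact ⟨w', by simp [MVal.upd], hr ▸ hw⟩
  | @cons t s s' d d' i c i' is is' q hi _ ih =>
    obtain ⟨rfl, hsd, ht⟩ := hq₀
    by_cases hd : d' = .pub
    · subst hd
      obtain ⟨l, l', rfl, rfl, hl⟩ := valRel_list_pub_iff.1 ha
      obtain ⟨n, hn, rfl⟩ := hi.uint_pre_pub
      cases hn
      simp only [updC, Option.bind_eq_bind, Option.bind_eq_some_iff, Option.some.injEq] at hr
      obtain ⟨b, hb, r₁, hr₁, rfl⟩ := hr
      obtain ⟨b', hb', hbb⟩ := forall₂_getElem? hl hb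
      obtain ⟨r₁', hr₁', hrr⟩ := ih ht hbb hw hr₁
      refine ⟨.list (l'.set n r₁'), by simp [MVal.upd, hb', hr₁'], ?_⟩
      exact valRel_list_pub_iff.2 ⟨_, _, rfl, rfl, forall₂_set hl n hrr⟩
    · obtain ⟨rfl, rfl⟩ := (valRel_hidden_iff hd).1 ha
      simp only [updC, Option.some.injEq] at hr
      exact ⟨.top, by simp [MVal.upd], hr ▸ valRel_top π _ hd⟩

/-! ## Simulation of the single constructs -/

/-- The circuit of the argument has the value `code b`, which is 0 exactly for `b = true`; thus
accepting this one output is the same as the success of the assertion. -/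
theorem simulated_assertion {π : CircuitInput} {T : Assoc QType} {M : Assoc Bool} {ν : Counter}
    {ω : Streams} {m : Option ℕ+} {d : Domain} {v : CVal} {c : Circuit} {v' : MVal} {γ : CEnv}
    {γ' : Env} (hv : ValRel π ⟨.bool m, .post, d⟩ (v, some c) v') (hγ : EnvRel π T M γ γ')
    (hω : StreamSim (bulletCounter ν π) ω) :
    Simulated π (ValRel π ⟨.unit, .pre, .pub⟩) T M ν ω ((.unit, none), γ, [c], ν, [])
      (match (generalizing := false) v' with
        | .bool false => none
        | _ => some (.unit, γ', ω)) := by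
  have hc : ∃ b, v' = .bool b ∧ c.value π = some (code b) := by
    rw [valRel_bool_iff] at hv
    have := @ConstCircuit.value
    grind
  obtain ⟨b, rfl, hc⟩ := hc
  cases b with
  | true =>
    refine fun _ => ⟨?_, by simp⟩
    rintro _ _ _ h
    cases h
    exact ⟨valRel_unit_iff.2 ⟨rfl, rfl⟩, hγ, by simp [Accepts, hc, code], hω, by simp⟩
  | false => exact fun _ => ⟨by simp, by simp [Accepts, hc, code]⟩

/-- The head of the stream matches the entry of `π` with index `ν p`, the number of the new node.
`Sim` leaves open whether that head is a number or a Boolean; type correctness of the streams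
decides it. -/
theorem simulated_input {π : CircuitInput} {T : Assoc QType} {M : Assoc Bool} {ν : Counter}
    {ω : Streams} {t : DataType} {N : ℕ+} (ht : t = .uint (some N) ∨ t = .bool (some N))
    {d : Domain} {p : Party} (hd : d.party = some p) {γ : CEnv} {γ' : Env}
    (hγ : EnvRel π T M γ γ') (hω : StreamSim (bulletCounter ν π) ω) :
    Simulated π (ValRel π ⟨t, .post, d⟩) T M ν ω
      ((.top, some (.inp p (ν p))), γ, [],
        fun p' => if p = p' then ν p' + 1 else ν p', [⟨p, ν p, t⟩])
      ((ω p).head?.bind fun h =>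
        some (h, γ', fun p' => if p' = p then (ω p').tail else ω p')) := by
  intro hι
  have hι := hι ⟨p, ν p, t⟩ (List.mem_singleton_self _)
  have hωp := hω p
  simp only [bulletCounter, List.forall₂_map_left_iff] at hωp
  simp only [le_refl, true_implies, Nat.sub_self] at hι
  rcases hl : ω p with _ | ⟨a, l⟩
  -- An empty stream means that `π` has at most `ν p` entries, so the new node has no input.
  · rw [hl, List.forall₂_nil_right_iff, List.drop_eq_nil_iff] at hωp
    refine ⟨by simp, fun _ hav => ?_⟩
    have := hav ⟨p, ν p, t⟩ (List.mem_singleton_self _)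
    simp only at this
    omega
  · rw [hl, List.forall₂_cons_right_iff] at hωp
    obtain ⟨n, r, hn, hr, hdrop⟩ := hωp
    have ha := hι a (by simp [hl])
    have hval : (Circuit.inp p (ν p)).value π = some n := by
      rw [Circuit.value, ← List.head?_drop, hdrop, List.head?_cons]
    have hr' : (π p).drop (ν p + 1) = r := by
      rw [← List.tail_drop, hdrop, List.tail_cons]
    have hdp : d ≠ .pub := by
      rintro rfl
      cases hd
    refine ⟨?_, by simp⟩
    rintro _ _ _ h
    simp only [List.head?_cons, Option.bind_some, Option.some.injEq, Prod.mk.injEq] at h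
    obtain ⟨rfl, rfl, rfl⟩ := h
    refine ⟨?_, hγ, by simp [Accepts], fun p' => ?_, fun p' => ?_⟩
    · rcases ht with rfl | rfl
      · rw [valRel_uint_iff]
        cases a <;> simp only [MVal.HasPrim] at ha
        cases sim_nat_nat_iff.1 hn
        exact .inr ⟨_, rfl, .inr ⟨_, rfl, .inr ⟨hdp, rfl, hval⟩⟩⟩
      · rw [valRel_bool_iff]
        cases a <;> simp only [MVal.HasPrim] at ha
        cases sim_nat_bool_iff.1 hn
        exact .inr ⟨_, rfl, .inr ⟨_, rfl, .inr ⟨hdp, rfl, hval⟩⟩⟩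
    · by_cases hp : p' = p
      · subst hp
        simpa [bulletCounter, hl, hr'] using hr
      · simpa [bulletCounter, hp, Ne.symm hp] using hω p'
    · by_cases hp : p' = p
      · subst hp
        simp
      · simp [hp, Ne.symm hp]

/-- The loop variable heads the environment, so setting it anew before each run preserves `EnvRel`.
-/
theorem simulated_loop {π : CircuitInput} {R : Comp → MVal → Prop} {T : Assoc QType}
    {M : Assoc Bool} {x : Var} {bodyC : CEnv → Counter → Option CompileResult}
    {body : Env → Streams → Option (MVal × Env × Streams)} {m : Option ℕ+}
    (hbody : ∀ γ γ' ν ω r, EnvRel π ((x, ⟨.uint m, .pre, .pub⟩) :: T) M γ γ' →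
      StreamSim (bulletCounter ν π) ω → bodyC γ ν = some r →
      Simulated π R ((x, ⟨.uint m, .pre, .pub⟩) :: T) M ν ω r (body γ' ω))
    (n i : ℕ) {γ : CEnv} {γ' : Env} {ν : Counter} {ω : Streams}
    {r : List Comp × CEnv × List Circuit × Counter × List InputNode}
    (hγ : EnvRel π ((x, ⟨.uint m, .pre, .pub⟩) :: T) M γ γ')
    (hω : StreamSim (bulletCounter ν π) ω) (hr : compileLoop bodyC x n i γ ν = some r) :
    Simulated π (List.Forall₂ R) ((x, ⟨.uint m, .pre, .pub⟩) :: T) M ν ω r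
      (circuitLoop body x n i γ' ω) := by
  induction n generalizing i γ γ' ν ω r with
  | zero =>
    simp only [compileLoop, Option.some.injEq] at hr
    subst hr
    exact .pure .nil hγ hω
  | succ n ih =>
    simp only [compileLoop, Option.bind_eq_bind, Option.bind_eq_some_iff, Option.some.injEq] at hr
    obtain ⟨⟨a, γ₁, o₁, ν₁, ι₁⟩, h₁, ⟨as, γ₂, o₂, ν₂, ι₂⟩, h₂, rfl⟩ := hr
    simp only [circuitLoop, Option.bind_eq_bind]
    refine (hbody _ _ _ _ _
      (hγ.update (by simp [Assoc.find]) (valRel_nat_pre_pub π m i)) hω h₁).bind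
      fun b γ₁' ω₁ hb hγ₁ hω₁ => ?_
    refine (ih (i + 1) hγ₁ hω₁ h₂).map fun bs γ₂' ω₂ hbs hγ₂ hω₂ => ?_
    exact .pure (.cons hb hbs) hγ₂ hω₂

/-! ## Simulation of expressions -/

theorem TypeCorrectInputs.mono {φ : Inputs} {e e' : Expr} (h : TypeCorrectInputs φ e)
    (he : e'.gets ⊆ e.gets) : TypeCorrectInputs φ e' :=
  fun d k q hq => h d k q (he hq)

/-- The circuit semantics of `e` is simulated by the compilation of `e`. -/
def Simulates (φ : Inputs) (π : CircuitInput) (e : Expr) : Prop :=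
  ∀ Γ q D, TyEnv.WellStructured Γ → HasType Γ e q D → TypeCorrectInputs φ e →
    ∀ M, Covers M → ∀ γ γ' ν ω r, EnvRel π Γ.typings M γ γ' → StreamSim (bulletCounter ν π) ω →
      compile φ e γ ν = some r →
      Simulated π (ValRel π q) Γ.typings M ν ω r (circuitSem φ e γ' ω)

/-- The evaluation of the indices of the L-value `l` is simulated by compilation. -/
def SimulatesIndices (φ : Inputs) (π : CircuitInput) (l : Expr) : Prop :=
  ∀ Γ q D x, TyEnv.WellStructured Γ → HasType Γ l q D → l.root = some x →
    TypeCorrectInputs φ l → ∃ q₀, TyEnv.lookupType Γ x = some q₀ ∧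
    ∀ M, Covers M → ∀ γ γ' ν ω r, EnvRel π Γ.typings M γ γ' → StreamSim (bulletCounter ν π) ω →
      compileIndices φ l γ ν = some r →
      Simulated π (fun is is' => PathRel π q₀ is is' q) Γ.typings M ν ω r
        (circuitIndices φ l γ' ω)

section

variable {φ : Inputs} {π : CircuitInput} {e₁ e₂ e₃ : Expr}

theorem simulates_var (x : Var) : Simulates φ π (.var x) := by
  intro Γ q D hΓ he hφ M hM γ γ' ν ω r hγ hω hr
  cases he with
  | var hx =>
    obtain ⟨w, v', hw, hv', h⟩ := hγ.find ((TyEnv.find_typings Γ x).trans hx) (hM x)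
    simp only [compile, hw, Option.bind_eq_bind, Option.bind_some, Option.some.injEq] at hr
    subst hr
    simp only [circuitSem, hv', Option.bind_eq_bind, Option.bind_some]
    exact .pure h hγ hω

theorem simulates_add {m : Option ℕ+} (ih₁ : Simulates φ π e₁) (ih₂ : Simulates φ π e₂) :
    Simulates φ π (.add m e₁ e₂) := by
  intro Γ q D hΓ he hφ M hM γ γ' ν ω r hγ hω hr
  cases he with
  | add hm he₁ he₂ =>
    simp only [compile, Option.bind_eq_bind, Option.bind_eq_some_iff, Option.some.injEq] at hr
    obtain ⟨⟨⟨v₁, c₁⟩, γ₁, o₁, ν₁, ι₁⟩, h₁, ⟨⟨v₂, c₂⟩, γ₂, o₂, ν₂, ι₂⟩, h₂, v, hv, rfl⟩ := hr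
    simp only [circuitSem, Option.bind_eq_bind]
    refine (ih₁ _ _ _ hΓ he₁ (hφ.mono (by simp [Expr.gets])) M hM _ _ _ _ _ hγ hω h₁).bind
      fun v₁' γ₁' ω₁ hv₁ hγ₁ hω₁ => ?_
    refine (ih₂ _ _ _ hΓ he₂ (hφ.mono (by simp [Expr.gets])) M hM _ _ _ _ _ hγ₁ hω₁ h₂).map
      fun v₂' γ₂' ω₂ hv₂ hγ₂ hω₂ => ?_
    obtain ⟨v', hv', h⟩ := hv₁.add hm hv₂ hv
    simp only [hv', Option.bind_some]
    exact .pure h hγ₂ hω₂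

theorem simulates_assertion (ih : Simulates φ π e₁) : Simulates φ π (.assertion e₁) := by
  intro Γ q D hΓ he hφ M hM γ γ' ν ω r hγ hω hr
  cases he with
  | assertion he =>
    simp only [compile, Option.bind_eq_bind, Option.bind_eq_some_iff, Option.some.injEq] at hr
    obtain ⟨⟨⟨v₁, c₁⟩, γ₁, o₁, ν₁, ι₁⟩, h₁, c, rfl, rfl⟩ := hr
    simp only [circuitSem, Option.bind_eq_bind]
    rw [← List.append_nil ι₁]
    exact (ih _ _ _ hΓ he hφ M hM _ _ _ _ _ hγ hω h₁).bind
      fun v' γ₁' ω₁ hv hγ₁ hω₁ => simulated_assertion hv hγ₁ hω₁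

theorem simulates_get (d : Domain) (k : Key) (q : QType) : Simulates φ π (.get d k q) := by
  intro Γ q D hΓ he hφ M hM γ γ' ν ω r hγ hω hr
  cases he with
  | get h =>
    rename_i t s d'
    simp only [compile, Option.some.injEq] at hr
    subst hr
    simp only [circuitSem]
    refine .pure ?_ hγ hω
    have hu := hφ d k ⟨t, s, d'⟩ (by simp [Expr.gets])
    by_cases hd : d = .pub
    · subst hd
      simpa using valRel_allPure π h hu
    · have : s = .pre ∧ d' = d := by cases t <;> simp_all [allPre]
      obtain ⟨rfl, rfl⟩ := this
      simpa [hd] using valRel_top π t hd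

theorem simulates_cond (ih₁ : Simulates φ π e₁) (ih₂ : Simulates φ π e₂)
    (ih₃ : Simulates φ π e₃) : Simulates φ π (.cond e₁ e₂ e₃) := by
  intro Γ q D hΓ he hφ M hM γ γ' ν ω r hγ hω hr
  cases he with
  | @cond _ _ _ _ m d' t s d D₁ D₂ D₃ he₁ he₂ he₃ hd =>
    simp only [compile, Option.bind_eq_bind, Option.bind_eq_some_iff] at hr
    obtain ⟨⟨⟨v₁, c₁⟩, γ₁, o₁, ν₁, ι₁⟩, h₁, hr⟩ := hr
    simp only [circuitSem, Option.bind_eq_bind]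
    have hs := ih₁ _ _ _ hΓ he₁ (hφ.mono (by simp [Expr.gets])) M hM _ _ _ _ _ hγ hω h₁
    -- The guard is unknown on both sides or has the same truth value on both.
    have hv : ∀ v₁', ValRel π ⟨.bool m, .pre, d'⟩ (v₁, c₁) v₁' →
        (v₁ = .top ∧ v₁' = .top ∧ d' ≠ .pub) ∨ ∃ b, v₁ = .bool b ∧ v₁' = .bool b := by
      intro v₁' h
      rw [valRel_bool_iff] at h
      grind
    rcases v₁ with _ | n | b | _ | l
    case bool =>
      cases b with
      | true =>
        simp only [Option.bind_eq_some_iff, Option.some.injEq] at hr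
        obtain ⟨⟨w, γ₂, o₂, ν₂, ι₂⟩, h₂, rfl⟩ := hr
        refine hs.bind fun v₁' γ₁' ω₁ hv₁ hγ₁ hω₁ => ?_
        obtain ⟨h, -⟩ | ⟨b, hb, rfl⟩ := hv _ hv₁
        · cases h
        cases hb
        exact ih₂ _ _ _ hΓ he₂ (hφ.mono (by simp [Expr.gets])) M hM _ _ _ _ _ hγ₁ hω₁ h₂
      | false =>
        simp only [Option.bind_eq_some_iff, Option.some.injEq] at hr
        obtain ⟨⟨w, γ₂, o₂, ν₂, ι₂⟩, h₂, rfl⟩ := hr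
        refine hs.bind fun v₁' γ₁' ω₁ hv₁ hγ₁ hω₁ => ?_
        obtain ⟨h, -⟩ | ⟨b, hb, rfl⟩ := hv _ hv₁
        · cases h
        cases hb
        exact ih₃ _ _ _ hΓ he₃ (hφ.mono (by simp [Expr.gets])) M hM _ _ _ _ _ hγ₁ hω₁ h₂
    all_goals
      cases hr
      refine hs.map fun v₁' γ₁' ω₁ hv₁ hγ₁ hω₁ => ?_
      obtain ⟨-, rfl, hd'⟩ | ⟨b, hb, -⟩ := hv _ hv₁
      case inr => cases hb
      -- An unknown guard has a non-public domain, and then the typing rule hides the type of the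
      -- branches. Neither semantics has run a branch, so the states still match.
      obtain ⟨rfl, hd₁⟩ := hidden_of_up_subset
        (Set.subset_union_left.trans (Set.subset_union_left.trans hd)) hd'
      exact .pure (valRel_top π t hd₁) hγ₁ hω₁

theorem simulates_loop (x : Var) (ih₁ : Simulates φ π e₁) (ih₂ : Simulates φ π e₂)
    (ih₃ : Simulates φ π e₃) : Simulates φ π (.loop x e₁ e₂ e₃) := by
  intro Γ q D hΓ he hφ M hM γ γ' ν ω r hγ hω hr
  cases he with
  | @loop _ _ _ _ _ d' t s d D₁ D₂ D₃ he₁ he₂ he₃ hd =>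
    simp only [compile, Option.bind_eq_bind, Option.bind_eq_some_iff] at hr
    obtain ⟨⟨⟨v₁, c₁⟩, γ₁, o₁, ν₁, ι₁⟩, h₁, ⟨⟨v₂, c₂⟩, γ₂, o₂, ν₂, ι₂⟩, h₂, hr⟩ := hr
    simp only [circuitSem, Option.bind_eq_bind]
    have hs₁ := ih₁ _ _ _ hΓ he₁ (hφ.mono (by simp [Expr.gets])) M hM _ _ _ _ _ hγ hω h₁
    have hs₂ := fun γ' ω hγ hω =>
      ih₂ _ _ _ hΓ he₂ (hφ.mono (by simp [Expr.gets])) M hM γ₁ γ' ν₁ ω _ hγ hω h₂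
    have hv : ∀ v₁ c₁ v₁', ValRel π ⟨.uint none, .pre, d'⟩ (v₁, c₁) v₁' →
        (v₁ = .top ∧ v₁' = .top ∧ d' ≠ .pub) ∨
          ∃ n, v₁ = .nat n ∧ v₁' = .nat n ∧ d' = .pub := by
      intro v₁ c₁ v₁' h
      rw [valRel_uint_iff] at h
      grind
    -- The bounds share the domain `d'`, so they are both known or both unknown, and alike in both
    -- semantics.
    by_cases hn : (∃ i₁, v₁ = .nat i₁) ∧ ∃ i₂, v₂ = .nat i₂
    · obtain ⟨⟨i₁, rfl⟩, i₂, rfl⟩ := hn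
      simp only [Option.bind_eq_some_iff, Option.some.injEq] at hr
      obtain ⟨⟨as, γ₃, o₃, ν₃, ι₃⟩, h₃, rfl⟩ := hr
      rw [List.append_assoc, List.append_assoc]
      refine hs₁.bind fun v₁' γ₁' ω₁ hv₁ hγ₁ hω₁ => ?_
      obtain ⟨h, -⟩ | ⟨n₁, hn₁, rfl, hd'⟩ := hv _ _ _ hv₁
      · cases h
      cases hn₁
      subst hd'
      refine (hs₂ _ _ hγ₁ hω₁).bind fun v₂' γ₂' ω₂ hv₂ hγ₂ hω₂ => ?_
      obtain ⟨h, -⟩ | ⟨n₂, hn₂, rfl, -⟩ := hv _ _ _ hv₂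
      · cases h
      cases hn₂
      have hb := simulated_loop (R := ValRel π ⟨t, s, d⟩) (T := Γ.typings)
        (M := (x, true) :: M) (x := x) (m := none)
        (body := fun γ ω => circuitSem φ e₃ γ ω)
        (fun γ γ' ν ω r hγ hω h => ih₃ _ _ _ (hΓ.cons_typing x (q := ⟨.uint none, .pre, .pub⟩) trivial) he₃
          (hφ.mono (by simp [Expr.gets])) _ (hM.cons x) γ γ' ν ω r hγ hω h)
        (i₂ - i₁) i₁ (hγ₂.push x (valRel_nat_pre_pub π none i₁)) hω₂ h₃
      refine hb.map fun as' γ₃' ω₃ has hγ₃ hω₃ => ?_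
      exact .pure (valRel_list_pub_iff.2 ⟨_, _, rfl, rfl, has⟩) hγ₃.pop hω₃
    · have hr : r = ((.top, none), γ₂, o₁ ++ o₂, ν₂, ι₁ ++ ι₂) := by
        cases v₁ <;> cases v₂ <;> simp_all
      subst hr
      refine hs₁.bind fun v₁' γ₁' ω₁ hv₁ hγ₁ hω₁ => ?_
      refine (hs₂ _ _ hγ₁ hω₁).map fun v₂' γ₂' ω₂ hv₂ hγ₂ hω₂ => ?_
      have hd' : v₁' = .top ∧ d' ≠ .pub := by
        have := hv _ _ _ hv₁
        have := hv _ _ _ hv₂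
        grind
      obtain ⟨rfl, hd'⟩ := hd'
      exact .pure (valRel_top π _ hd') hγ₂ hω₂

theorem simulates_wire (t : DataType) (d : Domain) (ih : Simulates φ π e₁) :
    Simulates φ π (.wire t d e₁) := by
  intro Γ q D hΓ he hφ M hM γ γ' ν ω r hγ hω hr
  cases he with
  | @wire _ _ N _ _ D ht he =>
    simp only [compile, Option.bind_eq_bind, Option.bind_eq_some_iff] at hr
    obtain ⟨⟨⟨v₁, c₁⟩, γ₁, o₁, ν₁, ι₁⟩, h₁, hr⟩ := hr
    simp only [circuitSem, Option.bind_eq_bind]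
    have hs := ih _ _ _ hΓ he hφ M hM _ _ _ _ _ hγ hω h₁
    by_cases hd : d = .pub
    · subst hd
      have hν : (fun p => if Domain.pub.party = some p then ν₁ p + 1 else ν₁ p) = ν₁ := by
        funext p
        simp [Domain.party]
      simp only [hν] at hr
      -- A public argument is known, so its node is a constant and the relation passes from stage
      -- `pre` to `post` without input.
      have hr' : ∃ w, r = (w, γ₁, o₁, ν₁, ι₁) ∧ ∀ v',
          ValRel π ⟨t, .pre, .pub⟩ (v₁, c₁) v' → ValRel π ⟨t, .post, .pub⟩ w v' := by
        cases v₁ with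
        | top => simp [Domain.party] at hr
        | unit => cases hr
        | list => cases hr
        | nat n =>
          cases hr
          refine ⟨_, rfl, fun v' h => ?_⟩
          rcases ht with rfl | rfl
          · rw [valRel_uint_iff] at h ⊢
            have := constCircuit_con n
            grind
          · rw [valRel_bool_iff] at h
            grind
        | bool b =>
          cases hr
          refine ⟨_, rfl, fun v' h => ?_⟩
          rcases ht with rfl | rfl
          · rw [valRel_uint_iff] at h
            grind
          · rw [valRel_bool_iff] at h ⊢
            have := constCircuit_con (code b)
            grind
      obtain ⟨w, rfl, hw⟩ := hr'
      exact hs.map fun v' γ₁' ω₁ hv hγ₁ hω₁ => .pure (hw _ hv) hγ₁ hω₁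
    · obtain ⟨p, hp⟩ := Option.ne_none_iff_exists'.1 (mt Domain.party_eq_none_iff.1 hd)
      simp only [hp, Option.some.injEq] at hr ⊢
      cases v₁ with
      | top =>
        simp only [Option.bind_some, Option.some.injEq] at hr
        subst hr
        rw [← List.append_nil o₁]
        exact hs.bind fun v' γ₁' ω₁ hv hγ₁ hω₁ => simulated_input ht hp hγ₁ hω₁
      | unit => cases hr
      | list => cases hr
      | _ =>
        cases hr
        refine hs.map fun v' γ₁' ω₁ hv hγ₁ hω₁ => ?_
        -- A value of a non-public type is never known to the compiler.
        cases ((valRel_hidden_iff hd).1 hv).1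

theorem simulates_cast (q : QType) (ih : Simulates φ π e₁) : Simulates φ π (.cast e₁ q) := by
  intro Γ q' D hΓ he hφ M hM γ γ' ν ω r hγ hω hr
  cases he with
  | cast he hs hd ht =>
    simp only [compile, Option.bind_eq_bind, Option.bind_eq_some_iff, Option.some.injEq] at hr
    obtain ⟨⟨⟨v₁, c₁⟩, γ₁, o₁, ν₁, ι₁⟩, h₁, rfl⟩ := hr
    simp only [circuitSem, Option.bind_eq_bind]
    refine (ih _ _ _ hΓ he hφ M hM _ _ _ _ _ hγ hω h₁).map
      fun v' γ₁' ω₁ hv hγ₁ hω₁ => ?_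
    exact .pure (hv.cast (he.wellStructured hΓ) hs hd) hγ₁ hω₁

theorem simulates_assign (ih₁ : SimulatesIndices φ π e₁) (ih₂ : Simulates φ π e₂) :
    Simulates φ π (.assign e₁ e₂) := by
  intro Γ q D hΓ he hφ M hM γ γ' ν ω r hγ hω hr
  cases he with
  | @assign _ _ _ x _ _ _ _ _ he₂ he₁ hx _ =>
    simp only [compile, Option.bind_eq_bind, Option.bind_eq_some_iff, Option.some.injEq] at hr
    obtain ⟨y, hy, a, ha, ⟨is, γ₁, o₁, ν₁, ι₁⟩, h₁, ⟨w, γ₂, o₂, ν₂, ι₂⟩, h₂, b, hb, rfl⟩ := hr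
    obtain rfl : x = y := Option.some.inj (hx.symm.trans hy)
    obtain ⟨q₀, hq₀, hi⟩ := ih₁ _ _ _ _ hΓ he₁ hx (hφ.mono (by simp [Expr.gets]))
    have hxT := (TyEnv.find_typings Γ x).trans hq₀
    -- The variable is read before its indices and the right-hand side are evaluated; the relation
    -- between the two old values does not depend on later environments and serves for the final
    -- update.
    obtain ⟨a₁, a', ha₁, ha', haa⟩ := hγ.find hxT (hM x)
    obtain rfl : a₁ = a := Option.some.inj (ha₁.symm.trans ha)
    simp only [circuitSem, hx, ha', Option.bind_eq_bind, Option.bind_some]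
    refine (hi M hM _ _ _ _ _ hγ hω h₁).bind fun is' γ₁' ω₁ his hγ₁ hω₁ => ?_
    refine (ih₂ _ _ _ hΓ he₂ (hφ.mono (by simp [Expr.gets])) M hM _ _ _ _ _ hγ₁ hω₁ h₂).map
      fun w' γ₂' ω₂ hw hγ₂ hω₂ => ?_
    obtain ⟨b', hb', hbb⟩ := his.upd (hΓ.lookupType hq₀) haa hw hb
    simp only [hb', Option.bind_some]
    exact .pure (valRel_unit_iff.2 ⟨rfl, rfl⟩) (hγ₂.update hxT hbb) hω₂

theorem simulates_load (ih₁ : Simulates φ π e₁) (ih₂ : Simulates φ π e₂) :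
    Simulates φ π (.load e₁ e₂) := by
  intro Γ q D hΓ he hφ M hM γ γ' ν ω r hγ hω hr
  cases he with
  | load _ he₁ he₂ =>
    simp only [compile, Option.bind_eq_bind, Option.bind_eq_some_iff, Option.some.injEq] at hr
    obtain ⟨⟨⟨a, c₁⟩, γ₁, o₁, ν₁, ι₁⟩, h₁, ⟨⟨i, c₂⟩, γ₂, o₂, ν₂, ι₂⟩, h₂, w, hw, rfl⟩ := hr
    simp only [circuitSem, Option.bind_eq_bind]
    refine (ih₁ _ _ _ hΓ he₁ (hφ.mono (by simp [Expr.gets])) M hM _ _ _ _ _ hγ hω h₁).bind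
      fun a' γ₁' ω₁ ha hγ₁ hω₁ => ?_
    refine (ih₂ _ _ _ hΓ he₂ (hφ.mono (by simp [Expr.gets])) M hM _ _ _ _ _ hγ₁ hω₁ h₂).map
      fun i' γ₂' ω₂ hi hγ₂ hω₂ => ?_
    obtain ⟨w', hw', h⟩ := ha.index (he₁.wellStructured hΓ) hi hw
    simp only [hw', Option.bind_some]
    exact .pure h hγ₂ hω₂

theorem simulates_letIn (b : Bool) (x : Var) (ih₁ : Simulates φ π e₁) (ih₂ : Simulates φ π e₂) :
    Simulates φ π (.letIn b x e₁ e₂) := by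
  intro Γ q D hΓ he hφ M hM γ γ' ν ω r hγ hω hr
  cases he with
  | letIn he₁ he₂ =>
    simp only [compile, Option.bind_eq_bind, Option.bind_eq_some_iff, Option.some.injEq] at hr
    obtain ⟨⟨w₁, γ₁, o₁, ν₁, ι₁⟩, h₁, ⟨w₂, γ₂, o₂, ν₂, ι₂⟩, h₂, rfl⟩ := hr
    simp only [circuitSem, Option.bind_eq_bind]
    refine (ih₁ _ _ _ hΓ he₁ (hφ.mono (by simp [Expr.gets])) M hM _ _ _ _ _ hγ hω h₁).bind
      fun v₁ γ₁' ω₁ hv₁ hγ₁ hω₁ => ?_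
    refine (ih₂ _ _ _ ((hΓ.cons_typing x (he₁.wellStructured hΓ)).cons_mutability x b) he₂
      (hφ.mono (by simp [Expr.gets])) _ (hM.cons x) _ _ _ _ _ (hγ₁.push x hv₁) hω₁ h₂).map
      fun v₂ γ₂' ω₂ hv₂ hγ₂ hω₂ => ?_
    exact .pure hv₂ hγ₂.pop hω₂

theorem simulates_seq (ih₁ : Simulates φ π e₁) (ih₂ : Simulates φ π e₂) :
    Simulates φ π (.seq e₁ e₂) := by
  intro Γ q D hΓ he hφ M hM γ γ' ν ω r hγ hω hr
  cases he with
  | seq he₁ he₂ =>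
    simp only [compile, Option.bind_eq_bind, Option.bind_eq_some_iff, Option.some.injEq] at hr
    obtain ⟨⟨w₁, γ₁, o₁, ν₁, ι₁⟩, h₁, ⟨w₂, γ₂, o₂, ν₂, ι₂⟩, h₂, rfl⟩ := hr
    simp only [circuitSem, Option.bind_eq_bind]
    exact (ih₁ _ _ _ hΓ he₁ (hφ.mono (by simp [Expr.gets])) M hM _ _ _ _ _ hγ hω h₁).bind
      fun v₁ γ₁' ω₁ _ hγ₁ hω₁ =>
        ih₂ _ _ _ hΓ he₂ (hφ.mono (by simp [Expr.gets])) M hM _ _ _ _ _ hγ₁ hω₁ h₂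

-- Indices of L-values.

theorem simulatesIndices_var (x : Var) : SimulatesIndices φ π (.var x) := by
  intro Γ q D y hΓ he hy hφ
  cases he with
  | var hx =>
    obtain rfl : x = y := by simpa [Expr.root] using hy
    refine ⟨q, hx, fun M hM γ γ' ν ω r hγ hω hr => ?_⟩
    simp only [compileIndices, Option.some.injEq] at hr
    subst hr
    exact .pure .nil hγ hω

theorem simulatesIndices_load (ih₁ : SimulatesIndices φ π e₁) (ih₂ : Simulates φ π e₂) :
    SimulatesIndices φ π (.load e₁ e₂) := by
  intro Γ q D x hΓ he hx hφ
  cases he with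
  | load _ he₁ he₂ =>
    obtain ⟨q₀, hq₀, hi⟩ := ih₁ _ _ _ x hΓ he₁ hx (hφ.mono (by simp [Expr.gets]))
    refine ⟨q₀, hq₀, fun M hM γ γ' ν ω r hγ hω hr => ?_⟩
    simp only [compileIndices, Option.bind_eq_bind, Option.bind_eq_some_iff,
      Option.some.injEq] at hr
    obtain ⟨⟨is, γ₁, o₁, ν₁, ι₁⟩, h₁, ⟨⟨i, c⟩, γ₂, o₂, ν₂, ι₂⟩, h₂, rfl⟩ := hr
    simp only [circuitIndices, Option.bind_eq_bind]
    refine (hi M hM _ _ _ _ _ hγ hω h₁).bind fun is' γ₁' ω₁ his hγ₁ hω₁ => ?_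
    refine (ih₂ _ _ _ hΓ he₂ (hφ.mono (by simp [Expr.gets])) M hM _ _ _ _ _ hγ₁ hω₁ h₂).map
      fun i' γ₂' ω₂ hi hγ₂ hω₂ => ?_
    exact .pure (his.concat hi) hγ₂ hω₂

theorem simulatesIndices_of_root_eq_none {e : Expr} (h : e.root = none) :
    SimulatesIndices φ π e := by
  intro Γ q D x _ _ hx
  simp [h] at hx

end

/-- Both claims go through one induction: an assignment evaluates the indices of its L-value but not
the L-value itself, and these indices are arbitrary expressions. -/
theorem simulates (φ : Inputs) (π : CircuitInput) (e : Expr) :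
    Simulates φ π e ∧ SimulatesIndices φ π e := by
  induction e with
  | eps =>
    refine ⟨?_, simulatesIndices_of_root_eq_none rfl⟩
    intro Γ q D hΓ he hφ M hM γ γ' ν ω r hγ hω hr
    cases he
    simp only [compile, Option.some.injEq] at hr
    subst hr
    simp only [circuitSem]
    exact .pure (valRel_unit_iff.2 ⟨rfl, rfl⟩) hγ hω
  | natLit n m s d =>
    refine ⟨?_, simulatesIndices_of_root_eq_none rfl⟩
    intro Γ q D hΓ he hφ M hM γ γ' ν ω r hγ hω hr
    cases he
    simp only [compile, Option.some.injEq] at hr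
    subst hr
    simp only [circuitSem]
    exact .pure (valRel_natLit π n m s d) hγ hω
  | boolLit b m s d =>
    refine ⟨?_, simulatesIndices_of_root_eq_none rfl⟩
    intro Γ q D hΓ he hφ M hM γ γ' ν ω r hγ hω hr
    cases he
    simp only [compile, Option.some.injEq] at hr
    subst hr
    simp only [circuitSem]
    exact .pure (valRel_boolLit π b m s d) hγ hω
  | var x => exact ⟨simulates_var x, simulatesIndices_var x⟩
  | add m e₁ e₂ ih₁ ih₂ => exact ⟨simulates_add ih₁.1 ih₂.1, simulatesIndices_of_root_eq_none rfl⟩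
  | assertion e ih => exact ⟨simulates_assertion ih.1, simulatesIndices_of_root_eq_none rfl⟩
  | get d k q => exact ⟨simulates_get d k q, simulatesIndices_of_root_eq_none rfl⟩
  | cond e₁ e₂ e₃ ih₁ ih₂ ih₃ =>
    exact ⟨simulates_cond ih₁.1 ih₂.1 ih₃.1, simulatesIndices_of_root_eq_none rfl⟩
  | loop x e₁ e₂ e₃ ih₁ ih₂ ih₃ =>
    exact ⟨simulates_loop x ih₁.1 ih₂.1 ih₃.1, simulatesIndices_of_root_eq_none rfl⟩
  | wire t d e ih => exact ⟨simulates_wire t d ih.1, simulatesIndices_of_root_eq_none rfl⟩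
  | cast e q ih => exact ⟨simulates_cast q ih.1, simulatesIndices_of_root_eq_none rfl⟩
  | assign l e ih₁ ih₂ =>
    exact ⟨simulates_assign ih₁.2 ih₂.1, simulatesIndices_of_root_eq_none rfl⟩
  | load l e ih₁ ih₂ => exact ⟨simulates_load ih₁.1 ih₂.1, simulatesIndices_load ih₁.2 ih₂.1⟩
  | letIn b x e₁ e₂ ih₁ ih₂ =>
    exact ⟨simulates_letIn b x ih₁.1 ih₂.1, simulatesIndices_of_root_eq_none rfl⟩
  | seq e₁ e₂ ih₁ ih₂ => exact ⟨simulates_seq ih₁.1 ih₂.1, simulatesIndices_of_root_eq_none rfl⟩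

end ZKSC

theorem mainTheorem1
    (Γ : TyEnv) (e : Expr) (t : DataType) (s : Stage) (d : Domain) (D : Set Domain)
    (hΓ : TyEnv.WellStructured Γ) (he : HasType Γ e ⟨t, s, d⟩ D)
    (γ : CEnv) (hγ : CEnvExact Γ γ)
    (φ : Inputs) (hφ : TypeCorrectInputs φ e)
    (ν : Counter)
    (v : CVal) (c : Option Circuit) (γr : CEnv) (o : List Circuit) (νr : Counter)
    (ι : List InputNode)
    (hcompile : compile φ e γ ν = some ((v, c), γr, o, νr, ι))
    (π : CircuitInput) (γ' : Env) (ω' : Streams)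
    (hγ' : ExactInCircuit Γ γ')
    (hγγ' : CEnvSim γ π γ')
    (hω' : StreamSim (bulletCounter ν π) ω')
    (hωt : TypeCorrectStreams ι ν ω') :
    (∀ (v' : MVal) (γr' : Env) (ωr' : Streams),
      circuitSem φ e γ' ω' = some (v', γr', ωr') →
        Accepts o π ∧
        CEnvSim γr π γr' ∧
        StreamSim (bulletCounter νr π) ωr' ∧
        (d = Domain.pub ∨ s = Stage.post → CompSim (v, c) π v')) ∧
    (circuitSem φ e γ' ω' = none → InputsAvailable ι π → ¬ Accepts o π) := by
  obtain ⟨M, hM, hγM⟩ := exists_envRel hγ hγ' hγγ'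
  obtain ⟨hs, hn⟩ := (simulates φ π e).1 Γ _ D hΓ he hφ M hM γ γ' ν ω' _ hγM hω' hcompile hωt
  refine ⟨fun v' γr' ωr' h => ?_, hn⟩
  obtain ⟨hv, hγr, ho, hωr, -⟩ := hs v' γr' ωr' h
  exact ⟨ho, hγr.cEnvSim hM, hωr, fun _ => hv.2.2⟩
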